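/- Let $\Gamma$ be a countable group and let $X$ be a compact metrizable abelian group, with a metric $d$ inducing its topology, on which $\Gamma$ acts by continuous group automorphisms. Suppose the action is expansive: there is $c>0$ such that for all $x\ne y$ in $X$ some $g\in\Gamma$ satisfies $d(gx,gy)>c$. Then there are an integer $k\ge 1$, a matrix $A\in M_k(\mathbb{Z}\Gamma)$ that is invertible in $M_k(\ell^1(\Gamma))$, where $\ell^1(\Gamma)$ is the convolution ring of absolutely summable real functions on $\Gamma$, and an injective continuous $\Gamma$-equivariant group homomorphism $\Phi:X\to X_A$, where $$X_A=\Big\{x\in\big((\mathbb{R}/\mathbb{Z})^k\big)^\Gamma : \sum_{j=1}^k\sum_{s\in\Gamma}A_{ij}(s)\,x(gs)_j=0 \text{ for all } g\in\Gamma,\ 1\le i\le k\Big\}$$ is the Pontryagin dual of the left $\mathbb{Z}\Gamma$-module $(\mathbb{Z}\Gamma)^k/(\mathbb{Z}\Gamma)^kA$, a compact metrizable abelian group on which $\Gamma$ acts by the continuous automorphisms $(gx)(h)=x(g^{-1}h)$. Moreover, for every metric $d$ on $X_A$ inducing its topology, the action of $\Gamma$ on $X_A$ is expansive and has the pseudo-orbit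 tracing property: for every $\epsilon>0$ there are $\delta>0$ and a finite set $S\subset\Gamma$ such that for every family $(x_g)_{g\in\Gamma}$ in $X_A$ with $d(s x_g,x_{sg})<\delta$ for all $s\in S$, $g\in\Gamma$, there is $x\in X_A$ with $d(gx,x_g)<\epsilon$ for all $g\in\Gamma$. -/

import Mathlib

noncomputable section

/-! ### Dynamics -/

/-- The action of `Γ` on `X` is expansive with respect to the metric `d`: there is an expansive
constant `c > 0` such that any two distinct points are moved more than `c` apart by some
element of `Γ`. -/
def IsExpansive (Γ : Type*) {X : Type*} [SMul Γ X] (d : X → X → ℝ) : Prop :=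
  ∃ c : ℝ, 0 < c ∧ ∀ x y : X, x ≠ y → ∃ g : Γ, c < d (g • x) (g • y)

/-- The family `x : Γ → X` is an `(S, δ)` pseudo-orbit of the action of `Γ` on `X`. -/
def IsPseudoOrbit {Γ X : Type*} [Mul Γ] [SMul Γ X] (d : X → X → ℝ) (S : Set Γ) (δ : ℝ)
    (x : Γ → X) : Prop :=
  ∀ s ∈ S, ∀ g : Γ, d (s • x g) (x (s * g)) < δ

/-- The family `x : Γ → X` is `ε`-traced by the point `y`. -/
def IsTracedBy {Γ X : Type*} [SMul Γ X] (d : X → X → ℝ) (ε : ℝ) (x : Γ → X) (y : X) : Prop :=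
  ∀ g : Γ, d (g • y) (x g) < ε

/-- The pseudo-orbit tracing property of the action of `Γ` on `X`, with respect to the
metric `d`. -/
def HasPseudoOrbitTracing (Γ : Type*) {X : Type*} [Mul Γ] [SMul Γ X] (d : X → X → ℝ) : Prop :=
  ∀ ε : ℝ, 0 < ε → ∃ δ : ℝ, 0 < δ ∧ ∃ S : Finset Γ,
    ∀ x : Γ → X, IsPseudoOrbit d (S : Set Γ) δ x → ∃ y : X, IsTracedBy d ε x y

/-! ### The convolution ring `ℓ¹(Γ)` -/

/-- The additive group underlying `ℓ¹(Γ)`: absolutely summable real functions on `Γ`. -/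
def ellOneSubgroup (Γ : Type*) : AddSubgroup (Γ → ℝ) where
  carrier := {f | Summable fun g => |f g|}
  zero_mem' := by simp [summable_zero]
  add_mem' {a b} ha hb :=
    Summable.of_nonneg_of_le (fun _ => abs_nonneg _) (fun g => abs_add_le (a g) (b g))
      (Summable.add ha hb)
  neg_mem' {a} ha := by simpa using ha

/-- The ring `ℓ¹(Γ)` of absolutely summable real functions on `Γ`, under convolution. -/
def EllOne (Γ : Type*) : Type _ := ellOneSubgroup Γ

namespace EllOne

variable {Γ : Type*}

instance instAddCommGroup : AddCommGroup (EllOne Γ) :=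
  inferInstanceAs (AddCommGroup (ellOneSubgroup Γ))

instance instCoeFun : CoeFun (EllOne Γ) (fun _ => Γ → ℝ) := ⟨fun f => f.1⟩

@[ext] theorem ext {a b : EllOne Γ} (h : ∀ g, a g = b g) : a = b := Subtype.ext (funext h)

@[simp] theorem add_apply (a b : EllOne Γ) (g : Γ) : (a + b) g = a g + b g := rfl

@[simp] theorem zero_apply (g : Γ) : (0 : EllOne Γ) g = 0 := rfl

theorem summable_abs (a : EllOne Γ) : Summable fun g => |a g| := a.2

theorem summable (a : EllOne Γ) : Summable fun g => a g := a.2.of_abs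

variable [Group Γ]

/-- The equivalence `(s, t) ↦ (s, s * t)`. -/
def shearEquiv (Γ : Type*) [Group Γ] : Γ × Γ ≃ Γ × Γ where
  toFun p := (p.1, p.1 * p.2)
  invFun p := (p.1, p.1⁻¹ * p.2)
  left_inv p := by simp
  right_inv p := by simp

theorem summable_conv_abs (a b : EllOne Γ) :
    Summable fun p : Γ × Γ => |a p.1| * |b (p.1⁻¹ * p.2)| := by
  rw [← (shearEquiv Γ).summable_iff]
  have h := Summable.mul_of_nonneg a.summable_abs b.summable_abs
    (fun _ => abs_nonneg _) (fun _ => abs_nonneg _)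
  refine h.congr fun _ => ?_
  simp [shearEquiv]

theorem summable_conv (a b : EllOne Γ) :
    Summable fun p : Γ × Γ => a p.1 * b (p.1⁻¹ * p.2) :=
  Summable.of_abs ((summable_conv_abs a b).congr fun _ => (abs_mul _ _).symm)

theorem summable_conv_abs_left (a b : EllOne Γ) (g : Γ) :
    Summable fun s => |a s| * |b (s⁻¹ * g)| :=
  ((Equiv.prodComm Γ Γ).summable_iff.mpr (summable_conv_abs a b)).prod_factor g

theorem summable_conv_left (a b : EllOne Γ) (g : Γ) :
    Summable fun s => a s * b (s⁻¹ * g) :=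
  Summable.of_abs ((summable_conv_abs_left a b g).congr fun _ => (abs_mul _ _).symm)

/-- Convolution: `(a * b) g = ∑ s, a s * b (s⁻¹ * g)`. -/
instance instMul : Mul (EllOne Γ) :=
  ⟨fun a b => ⟨fun g => ∑' s, a s * b (s⁻¹ * g), by
    have h := ((Equiv.prodComm Γ Γ).summable_iff.mpr (summable_conv_abs a b)).prod
    refine Summable.of_nonneg_of_le (fun _ => abs_nonneg _) (fun g => ?_) h
    have h2 : Summable fun s => ‖a s * b (s⁻¹ * g)‖ :=
      (summable_conv_abs_left a b g).congr fun s => by rw [Real.norm_eq_abs, abs_mul]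
    refine (norm_tsum_le_tsum_norm h2).trans (le_of_eq ?_)
    refine tsum_congr fun s => ?_
    simp⟩⟩

theorem mul_apply (a b : EllOne Γ) (g : Γ) : (a * b) g = ∑' s, a s * b (s⁻¹ * g) := rfl

/-- The identity of `ℓ¹(Γ)`: the indicator function of the identity element of `Γ`. -/
instance instOne : One (EllOne Γ) :=
  ⟨⟨Set.indicator {1} (fun _ => 1), by
    refine summable_of_ne_finset_zero (s := {1}) fun g hg => ?_
    have : g ≠ 1 := by simpa using hg
    simp [this]⟩⟩

theorem one_apply (g : Γ) : (1 : EllOne Γ) g = Set.indicator {1} (fun _ => (1 : ℝ)) g := rfl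

protected theorem mul_assoc' (a b c : EllOne Γ) : a * b * c = a * (b * c) := by
  ext g
  have hc : ∃ C, ∀ s, |c s| ≤ C :=
    ⟨∑' s, |c s|, fun s => c.summable_abs.le_tsum s (fun _ _ => abs_nonneg _)⟩
  obtain ⟨C, hC⟩ := hc
  have hs : Summable fun p : Γ × Γ => a p.1 * b (p.1⁻¹ * p.2) * c (p.2⁻¹ * g) := by
    refine Summable.of_abs ?_
    refine Summable.of_nonneg_of_le (fun _ => abs_nonneg _) (fun p => ?_)
      ((summable_conv_abs a b).mul_right C)
    rw [abs_mul, abs_mul]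
    exact mul_le_mul_of_nonneg_left (hC _) (by positivity)
  have e1 : (a * b * c) g = ∑' t, ∑' s, a s * b (s⁻¹ * t) * c (t⁻¹ * g) := by
    rw [mul_apply]
    exact tsum_congr fun t => by rw [mul_apply, tsum_mul_right]
  have e2 : (a * (b * c)) g = ∑' s, ∑' t, a s * b (s⁻¹ * t) * c (t⁻¹ * g) := by
    rw [mul_apply]
    refine tsum_congr fun s => ?_
    rw [mul_apply, ← tsum_mul_left,
      ← (Equiv.mulLeft s).tsum_eq fun t => a s * b (s⁻¹ * t) * c (t⁻¹ * g)]
    refine tsum_congr fun t => ?_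
    simp [mul_assoc]
  rw [e1, e2]
  exact Summable.tsum_comm hs

instance instRing : Ring (EllOne Γ) where
  __ := instAddCommGroup
  mul_assoc := EllOne.mul_assoc'
  one_mul a := by
    ext g
    rw [mul_apply, tsum_eq_single 1]
    · simp [one_apply]
    · intro s hs
      simp [one_apply, hs]
  mul_one a := by
    ext g
    rw [mul_apply, tsum_eq_single g]
    · simp [one_apply]
    · intro s hs
      have : s⁻¹ * g ≠ 1 := fun h => hs (inv_mul_eq_one.mp h)
      simp [one_apply, this]
  zero_mul a := by ext g; simp [mul_apply]
  mul_zero a := by ext g; simp [mul_apply]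
  left_distrib a b c := by
    ext g
    simp only [mul_apply, add_apply, mul_add]
    exact (summable_conv_left a b g).tsum_add (summable_conv_left a c g)
  right_distrib a b c := by
    ext g
    simp only [mul_apply, add_apply, add_mul]
    exact (summable_conv_left a c g).tsum_add (summable_conv_left b c g)

/-- The canonical inclusion of the integral group ring `ℤΓ` into `ℓ¹(Γ)`. -/
def ofGroupRing (a : MonoidAlgebra ℤ Γ) : EllOne Γ :=
  ⟨fun g => (a.coeff g : ℝ), by
    refine summable_of_ne_finset_zero (s := a.coeff.support) fun g hg => ?_
    simp [Finsupp.notMem_support_iff.mp hg]⟩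

end EllOne

/-! ### The algebraic action `X_A` -/

section XA

variable {Γ : Type*} [Group Γ] {k : ℕ}

/-- The pairing `⟨x, m⟩ = ∑ j, ∑ s, m_j(s) x(s)_j` of `((ℝ/ℤ)ᵏ)^Γ` with `(ℤΓ)ᵏ`, which identifies
the former group with the Pontryagin dual of the latter. -/
def groupRingPairing (x : Γ → Fin k → UnitAddCircle) (m : Fin k → MonoidAlgebra ℤ Γ) :
    UnitAddCircle :=
  ∑ j, (m j).coeff.sum fun s n => n • x s j

/-- The group `X_A`, for a `k × k` matrix `A` over `ℤΓ`: the Pontryagin dual of the left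
`ℤΓ`-module `(ℤΓ)ᵏ / (ℤΓ)ᵏ A`, realised as the closed subgroup of all `x` in `((ℝ/ℤ)ᵏ)^Γ` such that
`(x A*)_g = 0` for all `g`, i.e. `∑ j, ∑ s, A_ij(s) x(g s)_j = 0` for all `g` and `i`. -/
def XA (A : Matrix (Fin k) (Fin k) (MonoidAlgebra ℤ Γ)) :
    AddSubgroup (Γ → Fin k → UnitAddCircle) where
  carrier := {x | ∀ (g : Γ) (i : Fin k), ∑ j, (A i j).coeff.sum (fun s n => n • x (g * s) j) = 0}
  zero_mem' := by intro g i; simp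
  add_mem' {x y} hx hy := by
    intro g i
    have hx' := hx g i
    have hy' := hy g i
    simp only [Pi.add_apply, smul_add, Finsupp.sum_add, Finset.sum_add_distrib, hx', hy', add_zero]
  neg_mem' {x} hx := by
    intro g i
    have hx' := hx g i
    simp only [Finsupp.sum] at hx'
    simp only [Pi.neg_apply, smul_neg, Finsupp.sum, Finset.sum_neg_distrib, hx', neg_zero]

variable (A : Matrix (Fin k) (Fin k) (MonoidAlgebra ℤ Γ))

theorem groupRingPairing_add (x : Γ → Fin k → UnitAddCircle)
    (m m' : Fin k → MonoidAlgebra ℤ Γ) :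
    groupRingPairing x (m + m') = groupRingPairing x m + groupRingPairing x m' := by
  simp only [groupRingPairing, ← Finset.sum_add_distrib]
  refine Finset.sum_congr rfl fun j _ => ?_
  rw [Pi.add_apply, MonoidAlgebra.coeff_add]
  exact Finsupp.sum_add_index' (fun _ => zero_smul _ _) (fun _ _ _ => add_smul _ _ _)

theorem sum_coeff_single_mul (g : Γ) (n : ℤ) (a : MonoidAlgebra ℤ Γ) (y : Γ → UnitAddCircle) :
    (MonoidAlgebra.single g n * a).coeff.sum (fun s c => c • y s) =
      n • a.coeff.sum (fun s c => c • y (g * s)) := by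
  have hadd : ∀ (z : Γ → UnitAddCircle) (f f' : Γ →₀ ℤ), (f + f').sum (fun s c => c • z s) =
      f.sum (fun s c => c • z s) + f'.sum (fun s c => c • z s) := fun z f f' =>
    Finsupp.sum_add_index' (fun _ => zero_smul _ _) (fun _ _ _ => add_smul _ _ _)
  have hsingle : ∀ (z : Γ → UnitAddCircle) (h : Γ) (c : ℤ),
      (Finsupp.single h c).sum (fun s c => c • z s) = c • z h := fun z h c =>
    Finsupp.sum_single_index (zero_smul _ _)
  induction a using MonoidAlgebra.induction_linear with
  | zero => simp
  | add a b ha hb =>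
    rw [mul_add, MonoidAlgebra.coeff_add, MonoidAlgebra.coeff_add, hadd, ha, hb,
      hadd (fun s => y (g * s)), smul_add]
  | single h c =>
    rw [MonoidAlgebra.single_mul_single, MonoidAlgebra.coeff_single, MonoidAlgebra.coeff_single,
      hsingle, hsingle (fun s => y (g * s)), mul_smul]

/-- `X_A` is the annihilator of `(ℤΓ)ᵏ A` under the pairing of `((ℝ/ℤ)ᵏ)^Γ` with `(ℤΓ)ᵏ`. -/
theorem mem_XA_iff (x : Γ → Fin k → UnitAddCircle) :
    x ∈ XA A ↔ ∀ m : Fin k → MonoidAlgebra ℤ Γ, groupRingPairing x (Matrix.vecMul m A) = 0 := by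
  classical
  have key : ∀ (i : Fin k) (g : Γ) (n : ℤ),
      groupRingPairing x (Matrix.vecMul (Pi.single i (MonoidAlgebra.single g n)) A) =
        n • ∑ j, (A i j).coeff.sum (fun s c => c • x (g * s) j) := by
    intro i g n
    rw [groupRingPairing, Finset.smul_sum]
    refine Finset.sum_congr rfl fun j _ => ?_
    rw [Matrix.single_vecMul]
    exact sum_coeff_single_mul g n (A i j) fun s => x s j
  constructor
  · intro hx m
    rw [← Finset.univ_sum_single m]
    refine Finset.sum_induction _ (fun m => groupRingPairing x (Matrix.vecMul m A) = 0)
      (fun m m' h h' => by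
        simp only [Matrix.add_vecMul, groupRingPairing_add, h, h', add_zero])
      (by simp [groupRingPairing]) (fun i _ => ?_)
    induction m i using MonoidAlgebra.induction_linear with
    | zero => simp [groupRingPairing]
    | add a b ha hb => rw [Pi.single_add, Matrix.add_vecMul, groupRingPairing_add, ha, hb, add_zero]
    | single g n => rw [key, hx g i, smul_zero]
  · intro h g i
    have := h (Pi.single i (MonoidAlgebra.single g 1))
    rwa [key, one_smul] at this

/-- The canonical action of `Γ` on `X_A`: `(g • x)(h) = x(g⁻¹ h)`. -/
instance XA.instDistribMulAction : DistribMulAction Γ (XA A) where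
  smul g x := ⟨fun h => x.1 (g⁻¹ * h), fun h i => by
    simpa only [mul_assoc] using x.2 (g⁻¹ * h) i⟩
  one_smul x := Subtype.ext (funext fun h => congrArg x.1 (by simp))
  mul_smul a b x := Subtype.ext (funext fun h => congrArg x.1 (by simp [mul_assoc]))
  smul_zero g := rfl
  smul_add g x y := rfl

instance XA.instContinuousConstSMul : ContinuousConstSMul Γ (XA A) where
  continuous_const_smul g :=
    continuous_induced_rng.mpr
      (continuous_pi fun h => (continuous_apply (g⁻¹ * h)).comp continuous_subtype_val)

theorem isClosed_XA : IsClosed (XA A : Set (Γ → Fin k → UnitAddCircle)) := by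
  have : (XA A : Set (Γ → Fin k → UnitAddCircle)) =
      ⋂ (g : Γ) (i : Fin k),
        {x | ∑ j, (A i j).coeff.sum (fun s n => n • x (g * s) j) = 0} := by
    ext x
    simp only [Set.mem_iInter]
    rfl
  rw [this]
  refine isClosed_iInter fun g => isClosed_iInter fun i => isClosed_eq ?_ continuous_const
  unfold Finsupp.sum
  fun_prop

instance XA.instCompactSpace : CompactSpace (XA A) :=
  isCompact_iff_compactSpace.mp (isClosed_XA A).isCompact

instance XA.instMetrizableSpace [Countable Γ] : TopologicalSpace.MetrizableSpace (XA A) :=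
  haveI : TopologicalSpace.MetrizableSpace (Γ → Fin k → UnitAddCircle) :=
    UniformSpace.metrizableSpace
  Topology.IsEmbedding.subtypeVal.metrizableSpace

end XA

end

/-!
# Expansive algebraic actions embed into `X_A` with `A` invertible over `ℓ¹(Γ)`

Since the action is expansive with constant `c`, and the characters of the compact group `X`
separate its points (`exists_addCircle_character_ne_zero`), finitely many characters `χ_j` have
their common kernel inside the ball of radius `c`, and then the orbit map
`x ↦ (g ↦ (χ_j(g⁻¹ x))_j)` is an equivariant closed embedding of `X` into `((ℝ/ℤ)ᵏ)^Γ`.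
Let `Y` be its image and `J` the subgroup of `(ℤΓ)ᵏ` annihilating `Y`; by duality, `Y` is in turn the annihilator of `J`
(`exists_groupRingPairing_ne_zero`). A bounded function `x : Γ → ℝᵏ` orthogonal to `J` must vanish
(`eq_zero_of_orthogonal_annihilator`): the reduction modulo `ℤ` of a small multiple `t x` lies in
`Y`, and its whole orbit stays near `0`. By the Hahn–Banach theorem, the real span of `J` is
therefore dense in `ℓ¹(Γ)ᵏ`. Approximating the rows of the identity matrix by rational multiples
of elements of `J`, which yields an invertible matrix by the Neumann series, and clearing
denominators gives a matrix `A` with rows in `J` that is invertible over `ℓ¹(Γ)`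
(`EllOne.exists_isUnit_map_ofGroupRing`). As its rows are in `J`, the group `X_A` contains `Y`.

Both dynamical properties of `X_A` follow by lifting to bounded real functions, where `A` acts
invertibly (`matrixAct`). A point with small coordinates has a small lift that `A` maps to a small
integral function, hence to zero: this is expansiveness. For tracing, the values at the identity
of a pseudo-orbit form a function `Γ → (ℝ/ℤ)ᵏ` whose lift `y` is mapped by `A` to within a small
error `e` of an integral function `A y - e`; then `A⁻¹ (A y - e)` is uniformly close to `y` and
reduces modulo `ℤ` to a point of `X_A`.

Separation of points by characters is obtained from Gelfand duality. Given a unitary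
representation `U` of a compact abelian group, here the regular one on `L²`, the operators `U g`
together with a self-adjoint smoothing operator `T = ∫ f(g) U_g dμ(g)` lie in a commutative
C⋆-algebra. If `U x ≠ 1`, some `f` gives `U x * T ≠ T`, so a character `ψ` of the algebra
distinguishes `U x * T` from `T`; then `g ↦ ψ(U g)` is a character of the group, non-trivial at
`x`, and continuous because `g ↦ U g * T` is norm-continuous.
-/

noncomputable section

open MeasureTheory Topology Uniformity

/-! ### Characters from unitary representations of compact abelian groups -/

/-- Gelfand duality for a commuting self-adjoint family `s` in a C⋆-algebra: the bicommutant of `s`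
is a commutative C⋆-algebra, so its characters separate its points. -/
theorem exists_starSubalgebra_separating {A : Type*} [CStarAlgebra A] (s : Set A)
    (hcomm : ∀ a ∈ s, ∀ b ∈ s, a * b = b * a) (hstar : ∀ a ∈ s, star a ∈ s) :
    ∃ S : StarSubalgebra ℂ A, s ⊆ S ∧
      ∀ a : S, a ≠ 0 → ∃ ψ : S →ₐ[ℂ] ℂ, Continuous ψ ∧ ψ a ≠ 0 := by
  have hss : s ∪ star s = s := by
    refine Set.union_eq_left.mpr fun a ha => ?_
    simpa using hstar _ ha
  let S : StarSubalgebra ℂ A :=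
    StarSubalgebra.centralizer ℂ (StarSubalgebra.centralizer ℂ s : Set A)
  have hS : (S : Set A) = Set.centralizer (Set.centralizer s) := by
    rw [StarSubalgebra.coe_centralizer_centralizer, hss]
  have hclosed : IsClosed (S : Set A) := by
    rw [hS]; exact Set.isClosed_centralizer _
  have hmul : ∀ a b : S, a * b = b * a := fun a b =>
    Subtype.ext (Set.centralizer_centralizer_comm_of_comm hcomm _ (hS ▸ a.2) _ (hS ▸ b.2))
  let _ : CStarAlgebra S := StarSubalgebra.cstarAlgebra S (h_closed := hclosed)
  let _ : CommCStarAlgebra S := { mul_comm := hmul }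
  refine ⟨S, fun a ha => ?_, fun a ha => ?_⟩
  · rw [hS]
    exact fun b hb => (hb a ha).symm
  · by_contra! H
    refine ha ((gelfandTransform_isometry S).injective ?_)
    ext φ
    simpa using! H (WeakDual.CharacterSpace.toAlgHom φ) (map_continuous φ)

section Unitary

variable {G H : Type*} [Group G] [NormedAddCommGroup H] [InnerProductSpace ℂ H]
  (U : G →* (H ≃ₗᵢ[ℂ] H))

/-- The unitary operator `U g` as a bounded linear operator. -/
abbrev unitaryOp (g : G) : H →L[ℂ] H := (U g : H →L[ℂ] H)

theorem unitaryOp_mul (a b : G) : unitaryOp U (a * b) = unitaryOp U a * unitaryOp U b := by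
  ext h; simp [unitaryOp]

theorem star_unitaryOp [CompleteSpace H] (a : G) : star (unitaryOp U a) = unitaryOp U a⁻¹ := by
  rw [ContinuousLinearMap.star_eq_adjoint, eq_comm, ContinuousLinearMap.eq_adjoint_iff]
  intro x y
  change inner ℂ (U a⁻¹ x) y = inner ℂ x (U a y)
  rw [← (U a).inner_map_map (U a⁻¹ x) y]
  simp

end Unitary

/-- The left translate `g ↦ f (a⁻¹ g)` of `f` by `a`. -/
def leftTranslate {G : Type*} [Group G] [TopologicalSpace G] [IsTopologicalGroup G]
    (f : C(G, ℝ)) (a : G) : C(G, ℝ) := ⟨fun g => f (a⁻¹ * g), by fun_prop⟩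

theorem continuous_leftTranslate {G : Type*} [Group G] [TopologicalSpace G]
    [IsTopologicalGroup G] (f : C(G, ℝ)) : Continuous (leftTranslate f) := by
  refine ContinuousMap.continuous_of_continuous_uncurry _ ?_
  simp only [leftTranslate, Function.uncurry_def, ContinuousMap.coe_mk]
  fun_prop

theorem integrable_smoothing {G H : Type*} [Group G] [TopologicalSpace G] [CompactSpace G]
    [MeasurableSpace G] [BorelSpace G] (μ : Measure G) [IsProbabilityMeasure μ]
    [NormedAddCommGroup H] [InnerProductSpace ℂ H] (U : G →* (H ≃ₗᵢ[ℂ] H))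
    (hU : ∀ h, Continuous fun g => U g h) (f : C(G, ℝ)) (h : H) :
    Integrable (fun g => (f g : ℂ) • U g h) μ := by
  have hc : Continuous fun g => (f g : ℂ) • U g h :=
    (Complex.continuous_ofReal.comp f.continuous).smul (hU h)
  exact hc.integrable_of_hasCompactSupport (HasCompactSupport.of_compactSpace _)

section Smoothing

variable {G H : Type*} [CommGroup G] [TopologicalSpace G] [CompactSpace G]
  [MeasurableSpace G] [BorelSpace G] (μ : Measure G) [IsProbabilityMeasure μ]
  [NormedAddCommGroup H] [InnerProductSpace ℂ H]
  (U : G →* (H ≃ₗᵢ[ℂ] H)) (hU : ∀ h, Continuous fun g => U g h)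

/-- The operator `h ↦ ∫ f(g) U_g h dμ(g)` attached to a strongly continuous unitary
representation `U` and a continuous function `f`. -/
def smoothing (f : C(G, ℝ)) : H →L[ℂ] H :=
  LinearMap.mkContinuous
    { toFun := fun h => ∫ g, (f g : ℂ) • U g h ∂μ
      map_add' := fun h h' => by
        rw [← integral_add (integrable_smoothing μ U hU f h) (integrable_smoothing μ U hU f h')]
        simp only [map_add, smul_add]
      map_smul' := fun c h => by
        rw [RingHom.id_apply, ← integral_smul]
        simp only [map_smul, smul_comm c] } ‖f‖ fun h => by
    refine (norm_integral_le_of_norm_le_const (C := ‖f‖ * ‖h‖) (.of_forall fun g => ?_)).trans ?_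
    · rw [norm_smul, LinearIsometryEquiv.norm_map, Complex.norm_real]
      gcongr
      exact f.norm_coe_le_norm g
    · simp

theorem smoothing_apply (f : C(G, ℝ)) (h : H) :
    smoothing μ U hU f h = ∫ g, (f g : ℂ) • U g h ∂μ := rfl

theorem norm_smoothing_sub_le (f f' : C(G, ℝ)) :
    ‖smoothing μ U hU f - smoothing μ U hU f'‖ ≤ ‖f - f'‖ := by
  refine ContinuousLinearMap.opNorm_le_bound _ (norm_nonneg _) fun h => ?_
  have : (smoothing μ U hU f - smoothing μ U hU f') h = smoothing μ U hU (f - f') h := by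
    rw [_root_.sub_apply, smoothing_apply, smoothing_apply, smoothing_apply,
      ← integral_sub (integrable_smoothing μ U hU f h) (integrable_smoothing μ U hU f' h)]
    simp [sub_smul]
  rw [this]
  exact ContinuousLinearMap.le_of_opNorm_le _
    (LinearMap.mkContinuous_norm_le _ (norm_nonneg _) _) h

theorem unitaryOp_mul_smoothing [IsTopologicalGroup G] [CompleteSpace H]
    [μ.IsMulLeftInvariant] (f : C(G, ℝ)) (a : G) :
    unitaryOp U a * smoothing μ U hU f = smoothing μ U hU (leftTranslate f a) := by
  ext h
  rw [mul_apply_eq_comp, smoothing_apply, smoothing_apply,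
    ← integral_mul_left_eq_self (fun g => (leftTranslate f a g : ℂ) • U g h) a,
    ← ContinuousLinearMap.integral_comp_comm _ (integrable_smoothing μ U hU f h)]
  simp [leftTranslate]

theorem unitaryOp_comm_smoothing [CompleteSpace H] (f : C(G, ℝ)) (a : G) :
    unitaryOp U a * smoothing μ U hU f = smoothing μ U hU f * unitaryOp U a := by
  ext h
  rw [mul_apply_eq_comp, mul_apply_eq_comp, smoothing_apply,
    smoothing_apply, ← ContinuousLinearMap.integral_comp_comm _ (integrable_smoothing μ U hU f h)]
  refine integral_congr_ae (.of_forall fun g => ?_)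
  have : U a (U g h) = U g (U a h) := by
    change (U a * U g) h = (U g * U a) h
    rw [← map_mul, mul_comm, map_mul]
  simp [this]

/-- If `f` is symmetric, the smoothing operator is self-adjoint. -/
theorem star_smoothing [IsTopologicalGroup G] [CompleteSpace H] [μ.IsInvInvariant]
    (f : C(G, ℝ)) (hf : ∀ g, f g⁻¹ = f g) :
    star (smoothing μ U hU f) = smoothing μ U hU f := by
  rw [ContinuousLinearMap.star_eq_adjoint, eq_comm, ContinuousLinearMap.eq_adjoint_iff]
  intro x y
  rw [smoothing_apply, smoothing_apply, ← integral_inner (integrable_smoothing μ U hU f y),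
    ← inner_conj_symm, ← integral_inner (integrable_smoothing μ U hU f x), ← integral_conj,
    ← integral_inv_eq_self _ μ]
  refine integral_congr_ae (.of_forall fun g => ?_)
  have : inner ℂ (U g⁻¹ x) y = inner ℂ x (U g y) := by
    rw [← (U g).inner_map_map (U g⁻¹ x) y]
    simp
  simp only [inner_smul_right, hf, map_mul, Complex.conj_ofReal, inner_conj_symm, this]

/-- A unitary operator other than the identity acts non-trivially on the range of a smoothing
operator with symmetric kernel: the kernel is concentrated where `U` barely moves a vector
that is moved by the given operator. -/
theorem exists_smoothing_ne [CompleteSpace H] [μ.IsOpenPosMeasure] (x : G) (hx : U x ≠ 1) :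
    ∃ f : C(G, ℝ), (∀ g, f g⁻¹ = f g) ∧
      unitaryOp U x * smoothing μ U hU f ≠ smoothing μ U hU f := by
  obtain ⟨h, hh⟩ : ∃ h, U x h ≠ h := by
    by_contra! H
    exact hx (LinearIsometryEquiv.ext H)
  obtain ⟨ε, hε, hεx⟩ : ∃ ε : ℝ, 0 < ε ∧ 2 * ε < ‖U x h - h‖ := by
    have : 0 < ‖U x h - h‖ := norm_pos_iff.mpr (sub_ne_zero.mpr hh)
    exact ⟨‖U x h - h‖ / 3, by positivity, by linarith⟩
  -- This kernel is symmetric because `‖U g⁻¹ h - h‖ = ‖U g h - h‖`.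
  let f : C(G, ℝ) := ⟨fun g => max 0 (ε - ‖U g h - h‖), by have := hU h; fun_prop⟩
  have hf0 : ∀ g, 0 ≤ f g := fun g => le_max_left _ _
  have hfi : Integrable f μ :=
    f.continuous.integrable_of_hasCompactSupport (HasCompactSupport.of_compactSpace _)
  have hpos : 0 < ∫ g, f g ∂μ := by
    refine f.continuous.integral_pos_of_hasCompactSupport_nonneg_nonzero
      (HasCompactSupport.of_compactSpace _) hf0 (x := 1) ?_
    simp [f, hε.ne', hε.le]
  refine ⟨f, fun g => ?_, fun H => ?_⟩
  · have : ‖U g⁻¹ h - h‖ = ‖U g h - h‖ := by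
      rw [← (U g).norm_map (U g⁻¹ h - h), norm_sub_rev (U g h) h]
      simp
    simp only [f, ContinuousMap.coe_mk, this]
  · set c := ∫ g, f g ∂μ
    have hfc : Integrable (fun g => (f g : ℂ) • h) μ := hfi.ofReal.smul_const h
    have hdiff : ‖smoothing μ U hU f h - (c : ℂ) • h‖ ≤ ε * c := by
      rw [smoothing_apply, ← integral_complex_ofReal, ← integral_smul_const,
        ← integral_sub (integrable_smoothing μ U hU f h) hfc,
        ← integral_const_mul]
      refine norm_integral_le_of_norm_le (hfi.const_mul ε) (.of_forall fun g => ?_)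
      rw [← smul_sub, norm_smul, Complex.norm_real, Real.norm_of_nonneg (hf0 g), mul_comm]
      by_cases hg : ‖U g h - h‖ ≤ ε
      · exact mul_le_mul_of_nonneg_right hg (hf0 g)
      · have : f g = 0 := max_eq_left (by linarith)
        simp [this]
    have h1 : U x (smoothing μ U hU f h) = smoothing μ U hU f h := DFunLike.congr_fun H h
    have h2 : (c : ℂ) • (U x h - h) =
        (smoothing μ U hU f h - (c : ℂ) • h) - U x (smoothing μ U hU f h - (c : ℂ) • h) := by
      rw [map_sub, h1, map_smul, smul_sub]
      abel
    have h3 : c * ‖U x h - h‖ ≤ ε * c + ε * c := by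
      calc c * ‖U x h - h‖ = ‖(c : ℂ) • (U x h - h)‖ := by
            rw [norm_smul, Complex.norm_real, Real.norm_of_nonneg hpos.le]
        _ ≤ _ := by
            rw [h2]
            refine (norm_sub_le _ _).trans ?_
            rw [LinearIsometryEquiv.norm_map]
            exact add_le_add hdiff hdiff
    nlinarith

/-- A strongly continuous unitary representation of a compact abelian group that is non-trivial
at `x` produces a character of the group that is non-trivial at `x`. -/
theorem exists_character_of_representation [IsTopologicalGroup G] [CompleteSpace H]
    [μ.IsMulLeftInvariant] [μ.IsInvInvariant]
    [μ.IsOpenPosMeasure] (hU : ∀ h, Continuous fun g => U g h) (x : G) (hx : U x ≠ 1) :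
    ∃ χ : G →* ℂ, Continuous χ ∧ χ x ≠ 1 := by
  obtain ⟨f, hfs, hf⟩ := exists_smoothing_ne μ U hU x hx
  set T := smoothing μ U hU f with hT
  obtain ⟨S, hsS, hS⟩ := exists_starSubalgebra_separating
    (insert T (Set.range (unitaryOp U)))
    (by
      rintro _ (rfl | ⟨a, rfl⟩) _ (rfl | ⟨b, rfl⟩)
      · rfl
      · exact (unitaryOp_comm_smoothing μ U hU f b).symm
      · exact unitaryOp_comm_smoothing μ U hU f a
      · rw [← unitaryOp_mul, ← unitaryOp_mul, mul_comm])
    (by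
      rintro _ (rfl | ⟨a, rfl⟩)
      · rw [hT, star_smoothing μ U hU f hfs]
        exact Set.mem_insert _ _
      · rw [star_unitaryOp]
        exact Set.mem_insert_of_mem _ ⟨_, rfl⟩)
  let T' : S := ⟨T, hsS (Set.mem_insert _ _)⟩
  let V : G →* S :=
    { toFun := fun g => ⟨unitaryOp U g, hsS (Set.mem_insert_of_mem _ ⟨g, rfl⟩)⟩
      map_one' := Subtype.ext (by ext; simp [unitaryOp])
      map_mul' := fun a b => Subtype.ext (unitaryOp_mul U a b) }
  obtain ⟨ψ, hψc, hψ⟩ := hS (V x * T' - T') (by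
    rw [sub_ne_zero]
    exact fun H => hf (congrArg Subtype.val H))
  rw [map_sub, map_mul] at hψ
  have hψT : ψ T' ≠ 0 := fun H => hψ (by simp [H])
  refine ⟨(ψ : S →* ℂ).comp V, ?_, fun H => hψ ?_⟩
  · -- Only `g ↦ U g * T` is norm-continuous, hence the division by `ψ T'`.
    have hc : Continuous fun g => V g * T' := by
      refine continuous_induced_rng.mpr ?_
      have : (Subtype.val ∘ fun g => V g * T') = fun g => smoothing μ U hU (leftTranslate f g) := by
        funext g
        exact unitaryOp_mul_smoothing μ U hU f g
      rw [this]
      have hlip : LipschitzWith 1 (smoothing μ U hU) := LipschitzWith.of_dist_le_mul fun a b => by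
        simpa [dist_eq_norm] using norm_smoothing_sub_le μ U hU a b
      exact hlip.continuous.comp (continuous_leftTranslate f)
    have : ⇑((ψ : S →* ℂ).comp V) = fun g => ψ (V g * T') / ψ T' := by
      funext g
      rw [map_mul, mul_div_cancel_right₀ _ hψT]
      rfl
    rw [this]
    exact (hψc.comp hc).div_const _
  · have : ψ (V x) = 1 := H
    rw [this, one_mul, sub_self]

end Smoothing

/-! ### Characters of compact abelian groups separate points -/

section PeterWeyl

/-- The regular representation of an abelian topological group on `L²`, `(U_g h)(x) = h(g x)`;
commutativity makes this a homomorphism in spite of the action on the domain. -/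
def regularRep {G : Type*} [CommGroup G] [TopologicalSpace G] [IsTopologicalGroup G]
    [MeasurableSpace G] [BorelSpace G] (μ : Measure G) [μ.IsMulLeftInvariant] :
    G →* (Lp ℂ 2 μ ≃ₗᵢ[ℂ] Lp ℂ 2 μ) where
  toFun g :=
    { toFun := fun h => DomMulAct.mk g • h
      invFun := fun h => DomMulAct.mk g⁻¹ • h
      left_inv := fun h => by
        beta_reduce
        rw [← mul_smul, ← DomMulAct.mk_mul]
        simp
      right_inv := fun h => by
        beta_reduce
        rw [← mul_smul, ← DomMulAct.mk_mul]
        simp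
      map_add' := fun h h' => smul_add _ h h'
      map_smul' := fun c h => smul_comm _ c h
      norm_map' := fun h => DomMulAct.norm_smul_Lp _ h }
  map_one' := LinearIsometryEquiv.ext fun h => by
    change DomMulAct.mk (1 : G) • h = h
    rw [DomMulAct.mk_one, one_smul]
  map_mul' a b := LinearIsometryEquiv.ext fun h => by
    change DomMulAct.mk (a * b) • h = DomMulAct.mk a • DomMulAct.mk b • h
    rw [← mul_smul, ← DomMulAct.mk_mul, mul_comm]

/-- Applied to the regular representation, which is faithful because continuous functions separate
points. -/
theorem exists_character_ne_one {G : Type*} [CommGroup G] [TopologicalSpace G]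
    [IsTopologicalGroup G] [CompactSpace G] [T2Space G] {x : G} (hx : x ≠ 1) :
    ∃ χ : G →* ℂ, Continuous χ ∧ χ x ≠ 1 := by
  let _ : MeasurableSpace G := borel G
  have : BorelSpace G := ⟨rfl⟩
  let μ : Measure G := Measure.haarMeasure ⊤
  have : IsProbabilityMeasure μ := ⟨by
    simpa using Measure.haarMeasure_self (K₀ := (⊤ : TopologicalSpace.PositiveCompacts G))⟩
  have : Fact ((2 : ENNReal) ≠ ⊤) := ⟨by simp⟩
  refine exists_character_of_representation μ (regularRep μ) (fun h => ?_) x fun H => ?_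
  · change Continuous fun g : G => DomMulAct.mk g • h
    have := DomMulAct.continuous_mk (M := G)
    fun_prop
  · obtain ⟨f, hf1, hfx, -⟩ := exists_continuous_zero_one_of_isClosed
      (isClosed_singleton (x := (1 : G))) (isClosed_singleton (x := x)) (by simpa using hx.symm)
    let F : C(G, ℂ) := ⟨fun g => (f g : ℂ), by fun_prop⟩
    have hmem : MemLp F 2 μ :=
      F.continuous.memLp_of_hasCompactSupport (HasCompactSupport.of_compactSpace _)
    have h1 : DomMulAct.mk x • hmem.toLp F = hmem.toLp F :=
      DFunLike.congr_fun (F := Lp ℂ 2 μ ≃ₗᵢ[ℂ] Lp ℂ 2 μ) H (hmem.toLp F)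
    rw [DomMulAct.mk_smul_toLp, MemLp.toLp_eq_toLp_iff] at h1
    have h2 := (Continuous.ae_eq_iff_eq μ (by simp only [smul_eq_mul]; fun_prop) F.continuous).mp h1
    have h3 := congrFun h2 1
    have e1 : f x = 1 := hfx rfl
    have e2 : f 1 = 0 := hf1 rfl
    simp [F, e1, e2] at h3

/-- Continuous characters of a compact Hausdorff abelian group separate its points. -/
theorem exists_addCircle_character_ne_zero {G : Type*} [AddCommGroup G] [TopologicalSpace G]
    [IsTopologicalAddGroup G] [CompactSpace G] [T2Space G] {x : G} (hx : x ≠ 0) :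
    ∃ χ : G →+ UnitAddCircle, Continuous χ ∧ χ x ≠ 0 := by
  have : T2Space (Multiplicative G) := ‹T2Space G›
  obtain ⟨χ, hχ, hχx⟩ := exists_character_ne_one (x := Multiplicative.ofAdd x) (by simpa using hx)
  have hbdd : ∃ C : ℝ, ∀ g, ‖χ g‖ ≤ C := by
    obtain ⟨C, hC⟩ := (isCompact_range hχ).isBounded.exists_norm_le
    exact ⟨C, fun g => hC _ ⟨g, rfl⟩⟩
  obtain ⟨C, hC⟩ := hbdd
  -- A bounded character takes values in the unit circle, by considering powers.
  have hle : ∀ g, ‖χ g‖ ≤ 1 := fun g => by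
    by_contra! hlt
    obtain ⟨n, hn⟩ := pow_unbounded_of_one_lt C hlt
    have := hC (g ^ n)
    rw [map_pow, norm_pow] at this
    linarith
  have hone : ∀ g, ‖χ g‖ = 1 := fun g => by
    refine le_antisymm (hle g) ?_
    have h1 : ‖χ g‖ * ‖χ g⁻¹‖ = 1 := by
      rw [← norm_mul, ← map_mul]; simp
    nlinarith [hle g⁻¹, norm_nonneg (χ g)]
  let e := AddCircle.homeomorphCircle (one_ne_zero (α := ℝ))
  have he : ∀ a b, e.symm (a * b) = e.symm a + e.symm b := fun a b => by
    apply e.injective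
    rw [e.apply_symm_apply, AddCircle.homeomorphCircle_apply, AddCircle.toCircle_add,
      ← AddCircle.homeomorphCircle_apply one_ne_zero,
      ← AddCircle.homeomorphCircle_apply one_ne_zero]
    simp [e]
  let c : G → Circle := fun g =>
    ⟨χ (Multiplicative.ofAdd g), mem_sphere_zero_iff_norm.mpr (hone _)⟩
  have hc : ∀ a b, c (a + b) = c a * c b := fun a b => Circle.ext (by rw [Circle.coe_mul]; simp [c])
  refine ⟨AddMonoidHom.mk' (fun g => e.symm (c g)) fun a b => by rw [hc, he], ?_, fun H => hχx ?_⟩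
  · refine e.symm.continuous.comp (continuous_induced_rng.mpr ?_)
    exact hχ.comp continuous_ofAdd
  · have h0 : e.symm (c x) = 0 := H
    have h1 : c x = 1 := by
      rw [← e.apply_symm_apply (c x), h0]
      simp [e, AddCircle.homeomorphCircle_apply]
    exact congrArg (fun z : Circle => (z : ℂ)) h1

end PeterWeyl

/-! ### Duality between `((ℝ/ℤ)ᵏ)^Γ` and `(ℤΓ)ᵏ` -/

section Circle

/-- Every point of `ℝ/ℤ` has a real representative whose absolute value is its norm. -/
theorem UnitAddCircle.exists_coe_eq (t : UnitAddCircle) :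
    ∃ r : ℝ, (r : UnitAddCircle) = t ∧ |r| = ‖t‖ := by
  obtain ⟨s, rfl⟩ := QuotientAddGroup.mk_surjective t
  refine ⟨s - round s, ?_, (UnitAddCircle.norm_eq (x := s)).symm⟩
  rw [AddCircle.coe_sub, sub_eq_self]
  exact (AddCircle.coe_eq_zero_iff 1).mpr ⟨round s, by simp⟩

theorem UnitAddCircle.norm_coe_of_abs_le {r : ℝ} (hr : |r| ≤ 1 / 2) :
    ‖(r : UnitAddCircle)‖ = |r| :=
  (AddCircle.norm_coe_eq_abs_iff 1 one_ne_zero).mpr (by simpa using hr)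

theorem UnitAddCircle.norm_coe_le (r : ℝ) : ‖(r : UnitAddCircle)‖ ≤ |r| := by
  rw [UnitAddCircle.norm_eq]
  simpa using round_le r 0

/-- The circle has no small subgroups. -/
theorem UnitAddCircle.eq_zero_of_forall_norm_nsmul_lt {t : UnitAddCircle}
    (ht : ∀ n : ℕ, ‖n • t‖ < 1 / 4) : t = 0 := by
  have hdouble : ∀ s : UnitAddCircle, ‖s‖ < 1 / 4 → ‖2 • s‖ = 2 * ‖s‖ := fun s hs => by
    obtain ⟨r, rfl, hr⟩ := UnitAddCircle.exists_coe_eq s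
    rw [← hr] at hs ⊢
    rw [← AddCircle.coe_nsmul, UnitAddCircle.norm_coe_of_abs_le, nsmul_eq_mul, abs_mul]
    · simp
    · rw [nsmul_eq_mul, abs_mul]
      norm_num
      linarith
  have hpow : ∀ n : ℕ, ‖2 ^ n • t‖ = 2 ^ n * ‖t‖ := fun n => by
    induction n with
    | zero => simp
    | succ n ih => rw [pow_succ', mul_smul, hdouble _ (ht _), ih, pow_succ', mul_assoc]
  by_contra h0
  have hpos : 0 < ‖t‖ := norm_pos_iff.mpr h0
  obtain ⟨n, hn⟩ := pow_unbounded_of_one_lt (1 / ‖t‖) one_lt_two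
  have h1 := ht (2 ^ n)
  rw [hpow] at h1
  rw [div_lt_iff₀ hpos] at hn
  linarith

/-- The continuous endomorphisms of the circle are the multiplications by integers: some Fourier
coefficient of the character does not vanish, and invariance of Haar measure identifies the
character with that exponential. -/
theorem UnitAddCircle.exists_zsmul_eq (χ : UnitAddCircle →+ UnitAddCircle) (hχ : Continuous χ) :
    ∃ n : ℤ, ∀ t, χ t = n • t := by
  let f : C(UnitAddCircle, ℂ) := ⟨fun t => (AddCircle.toCircle (χ t) : ℂ),
    continuous_subtype_val.comp (AddCircle.continuous_toCircle.comp hχ)⟩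
  obtain ⟨n, hn⟩ : ∃ n, fourierCoeff f n ≠ 0 := by
    by_contra! H
    have hs : Summable (fourierCoeff f) := by
      rw [funext H]
      exact summable_zero
    have h0 := has_pointwise_sum_fourier_series_of_summable hs 0
    simp only [H, zero_smul] at h0
    have := h0.unique hasSum_zero
    simp [f] at this
  refine ⟨n, fun a => AddCircle.injective_toCircle one_ne_zero (Circle.ext ?_)⟩
  have hinv : fourierCoeff f n = fourier (-n) a * f a * fourierCoeff f n := by
    have hf : ∀ t, fourier (-n) (a + t) • f (a + t) =
        (fourier (-n) a * f a) * (fourier (-n) t • f t) := fun t => by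
      have h1 : f (a + t) = f a * f t := by
        simp [f, map_add, AddCircle.toCircle_add]
      have h2 : (fourier (-n) (a + t) : ℂ) = fourier (-n) a * fourier (-n) t := by
        simp [fourier_apply, smul_add, AddCircle.toCircle_add]
      rw [h1, h2, smul_eq_mul, smul_eq_mul]
      ring
    rw [fourierCoeff, ← integral_const_mul]
    simp only [← hf]
    exact (integral_add_left_eq_self (fun t => fourier (-n) t • f t) a).symm
  have h1 : fourier (-n) a * f a = 1 := by
    have : (fourier (-n) a * f a - 1) * fourierCoeff f n = 0 := by linear_combination -hinv
    exact sub_eq_zero.mp ((mul_eq_zero.mp this).resolve_right hn)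
  have h2 : (fourier (-n) a : ℂ) * fourier n a = 1 := by
    rw [← fourier_add, neg_add_cancel, fourier_zero]
  have h3 : (fourier (-n) a : ℂ) ≠ 0 := left_ne_zero_of_mul_eq_one h2
  have h4 := mul_left_cancel₀ h3 (h1.trans h2.symm)
  rwa [fourier_apply] at h4

end Circle

section Duality

variable {Γ : Type*} {k : ℕ}

/-- Every continuous character of `((ℝ/ℤ)ᵏ)^Γ` is the pairing with an element of `(ℤΓ)ᵏ`. -/
theorem exists_groupRingPairing_eq (χ : (Γ → Fin k → UnitAddCircle) →+ UnitAddCircle)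
    (hχ : Continuous χ) :
    ∃ m : Fin k → MonoidAlgebra ℤ Γ, ∀ x, χ x = groupRingPairing x m := by
  classical
  have hball : χ ⁻¹' Metric.ball 0 (1 / 4) ∈ 𝓝 (0 : Γ → Fin k → UnitAddCircle) :=
    hχ.continuousAt.preimage_mem_nhds (by rw [map_zero]; exact Metric.ball_mem_nhds _ (by norm_num))
  rw [nhds_pi, Filter.mem_pi'] at hball
  obtain ⟨I, t, ht, hI⟩ := hball
  -- Points vanishing on `I` form a subgroup mapped into a small ball, hence to zero.
  have hker : ∀ x : Γ → Fin k → UnitAddCircle, (∀ g ∈ I, x g = 0) → χ x = 0 := fun x hx => by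
    refine UnitAddCircle.eq_zero_of_forall_norm_nsmul_lt fun n => ?_
    have : n • x ∈ (I : Set Γ).pi t := fun g hg => by
      rw [Pi.smul_apply, hx g hg, smul_zero]
      exact mem_of_mem_nhds (ht g)
    simpa using hI this
  have hsingle : ∀ (g : Γ) (j : Fin k), ∃ n : ℤ, ∀ t, χ (Pi.single g (Pi.single j t)) = n • t := by
    intro g j
    have hc : Continuous fun t : UnitAddCircle =>
        (Pi.single g (Pi.single j t) : Γ → Fin k → UnitAddCircle) :=
      (continuous_single (A := fun _ : Γ => Fin k → UnitAddCircle) g).comp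
        (continuous_single (A := fun _ : Fin k => UnitAddCircle) j)
    exact UnitAddCircle.exists_zsmul_eq
      ((χ.comp (AddMonoidHom.single (fun _ : Γ => Fin k → UnitAddCircle) g)).comp
        (AddMonoidHom.single (fun _ : Fin k => UnitAddCircle) j))
      (hχ.comp hc)
  choose n hn using hsingle
  refine ⟨fun j => .ofCoeff (Finsupp.onFinset I (fun g => if g ∈ I then n g j else 0)
    fun g hg => by by_contra h; simp [h] at hg), fun x => ?_⟩
  have hsum : χ x = χ (∑ g ∈ I, Pi.single g (x g)) := by
    rw [← sub_eq_zero, ← map_sub]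
    refine hker _ fun g hg => ?_
    rw [Pi.sub_apply, Finset.sum_apply, Finset.sum_eq_single g]
    · simp
    · exact fun b _ hb => Pi.single_eq_of_ne hb.symm _
    · exact fun h => absurd hg h
  have hfin : ∀ g, χ (Pi.single g (x g)) = ∑ j, n g j • x g j := fun g => by
    have : (Pi.single g (x g) : Γ → Fin k → UnitAddCircle) =
        ∑ j, Pi.single g (Pi.single j (x g j)) := by
      conv_lhs => rw [← Finset.univ_sum_single (x g)]
      exact map_sum (AddMonoidHom.single (fun _ : Γ => Fin k → UnitAddCircle) g) _ _
    rw [this, map_sum]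
    exact Finset.sum_congr rfl fun j _ => hn g j _
  rw [hsum, map_sum, groupRingPairing]
  simp only [hfin]
  rw [Finset.sum_comm]
  refine Finset.sum_congr rfl fun j _ => ?_
  refine Eq.trans ?_ (Finsupp.onFinset_sum _ (fun g => zero_smul ℤ (x g j))).symm
  exact Finset.sum_congr rfl fun g hg => by rw [if_pos hg]

/-- A closed subgroup of `((ℝ/ℤ)ᵏ)^Γ` is cut out by the elements of `(ℤΓ)ᵏ` that annihilate it. -/
theorem exists_groupRingPairing_ne_zero (Y : AddSubgroup (Γ → Fin k → UnitAddCircle))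
    (hY : IsClosed (Y : Set (Γ → Fin k → UnitAddCircle))) {y : Γ → Fin k → UnitAddCircle}
    (hy : y ∉ Y) :
    ∃ m : Fin k → MonoidAlgebra ℤ Γ,
      (∀ z ∈ Y, groupRingPairing z m = 0) ∧ groupRingPairing y m ≠ 0 := by
  have : IsClosed (Y : Set (Γ → Fin k → UnitAddCircle)) := hY
  obtain ⟨χ, hχ, hχy⟩ := exists_addCircle_character_ne_zero
    (x := (y : (Γ → Fin k → UnitAddCircle) ⧸ Y))
    (by rwa [Ne, QuotientAddGroup.eq_zero_iff])
  obtain ⟨m, hm⟩ := exists_groupRingPairing_eq (χ.comp (QuotientAddGroup.mk' Y))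
    (hχ.comp continuous_quotient_mk')
  refine ⟨m, fun z hz => ?_, ?_⟩
  · rw [← hm]
    simp [(QuotientAddGroup.eq_zero_iff z).mpr hz]
  · rw [← hm]
    exact hχy

end Duality

/-! ### The Banach algebra `ℓ¹(Γ)` and integral matrices invertible over it -/

open scoped Matrix.Norms.Operator in
/-- A matrix over a complete normed ring whose rows are close to those of the identity is
invertible. -/
theorem Matrix.isUnit_of_norm_sub_lt {R : Type*} [NormedRing R] [CompleteSpace R] {k : ℕ}
    (C : Matrix (Fin k) (Fin k) R)
    (hC : ∀ i j, ‖(1 - C) i j‖ ≤ 1 / (k + 1 : ℝ)) : IsUnit C := by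
  have : @CompleteSpace (Matrix (Fin k) (Fin k) R) PseudoMetricSpace.toUniformSpace :=
    Matrix.instCompleteSpace ..
  rw [← sub_sub_cancel 1 C]
  refine isUnit_one_sub_of_norm_lt_one ?_
  have hle : ‖1 - C‖₊ ≤ k * (1 / (k + 1 : NNReal)) := by
    rw [Matrix.linfty_opNNNorm_def]
    refine Finset.sup_le fun i _ => ?_
    refine (Finset.sum_le_card_nsmul _ _ (1 / (k + 1 : NNReal)) fun j _ => ?_).trans ?_
    · exact_mod_cast hC i j
    · simp
  have hlt : (k : ℝ) * (1 / (k + 1 : ℝ)) < 1 := by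
    rw [mul_one_div, div_lt_one (by positivity)]
    linarith
  refine lt_of_le_of_lt ?_ hlt
  exact_mod_cast hle

namespace EllOne

section Normed

variable {Γ : Type*}

/-- `ℓ¹(Γ)` as Mathlib's space `lp` of exponent one. -/
def toLp : EllOne Γ ≃+ lp (fun _ : Γ => ℝ) 1 where
  toFun a := ⟨a.1, (memℓp_gen_iff (by simp)).mpr (by simpa using a.summable_abs)⟩
  invFun f := ⟨f.1, by
    change Summable fun g => |f.1 g|
    simpa using (memℓp_gen_iff (by simp)).mp f.2⟩
  left_inv _ := rfl
  right_inv _ := rfl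
  map_add' _ _ := rfl

instance instNormedAddCommGroup : NormedAddCommGroup (EllOne Γ) :=
  NormedAddCommGroup.induced (EllOne Γ) (lp (fun _ : Γ => ℝ) 1) toLp toLp.injective

theorem norm_eq_tsum (a : EllOne Γ) : ‖a‖ = ∑' g, |a g| := by
  change ‖toLp a‖ = _
  rw [lp.norm_eq_tsum_rpow (by simp)]
  simp only [ENNReal.toReal_one, Real.rpow_one, Real.norm_eq_abs, div_one]
  rfl

theorem isometry_toLp : Isometry (toLp (Γ := Γ)) :=
  AddMonoidHomClass.isometry_of_norm toLp fun _ => rfl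

instance instCompleteSpace : CompleteSpace (EllOne Γ) :=
  (IsometryEquiv.mk toLp.toEquiv isometry_toLp).completeSpace

instance instModule : Module ℝ (EllOne Γ) where
  smul r a := ⟨fun g => r * a g, by
    have := a.summable_abs.mul_left |r|
    exact this.congr fun g => (abs_mul _ _).symm⟩
  one_smul a := ext fun g => one_mul (a g)
  mul_smul r s a := ext fun g => mul_assoc r s (a g)
  smul_zero r := ext fun _ => mul_zero r
  smul_add r a b := ext fun g => mul_add r (a g) (b g)
  add_smul r s a := ext fun g => add_mul r s (a g)
  zero_smul a := ext fun g => zero_mul (a g)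

@[simp] theorem smul_apply (r : ℝ) (a : EllOne Γ) (g : Γ) : (r • a) g = r * a g := rfl

instance instNormedSpace : NormedSpace ℝ (EllOne Γ) where
  norm_smul_le r a := by
    rw [norm_eq_tsum, norm_eq_tsum, ← tsum_mul_left]
    simp [abs_mul]

/-- The function supported at the point `s`, with value `r` there. -/
def single [DecidableEq Γ] (s : Γ) (r : ℝ) : EllOne Γ := toLp.symm (lp.single 1 s r)

theorem single_apply [DecidableEq Γ] (s : Γ) (r : ℝ) (g : Γ) :
    single s r g = Pi.single (M := fun _ => ℝ) s r g := rfl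

theorem norm_single [DecidableEq Γ] (s : Γ) (r : ℝ) : ‖single s r‖ = |r| := by
  change ‖lp.single (E := fun _ : Γ => ℝ) 1 s r‖ = _
  rw [lp.norm_single (by simp), Real.norm_eq_abs]

theorem hasSum_single [DecidableEq Γ] (a : EllOne Γ) : HasSum (fun s => single s (a s)) a := by
  have h := lp.hasSum_single (p := 1) (by simp) (toLp a)
  have hc : Continuous (toLp (Γ := Γ)).symm :=
    (IsometryEquiv.mk toLp.toEquiv isometry_toLp).symm.continuous
  exact h.map (toLp (Γ := Γ)).symm hc

theorem ofGroupRing_apply (a : MonoidAlgebra ℤ Γ) (g : Γ) : ofGroupRing a g = a.coeff g := rfl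

end Normed

variable {Γ : Type*} [Group Γ]

instance instNormedRing : NormedRing (EllOne Γ) where
  __ := instNormedAddCommGroup
  __ := instRing
  norm_mul_le a b := by
    rw [norm_eq_tsum, norm_eq_tsum, norm_eq_tsum]
    have hs : Summable fun p : Γ × Γ => |a p.2| * |b (p.2⁻¹ * p.1)| :=
      (Equiv.prodComm Γ Γ).summable_iff.mpr (summable_conv_abs a b)
    calc ∑' g, |(a * b) g| ≤ ∑' g, ∑' s, |a s| * |b (s⁻¹ * g)| := by
          refine (a * b).summable_abs.tsum_le_tsum (fun g => ?_) hs.prod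
          have h2 : Summable fun s => ‖a s * b (s⁻¹ * g)‖ :=
            (summable_conv_abs_left a b g).congr fun s => by rw [Real.norm_eq_abs, abs_mul]
          refine (norm_tsum_le_tsum_norm h2).trans (le_of_eq (tsum_congr fun s => ?_))
          rw [Real.norm_eq_abs, abs_mul]
      _ = ∑' s, ∑' g, |a s| * |b (s⁻¹ * g)| := Summable.tsum_comm (summable_conv_abs a b)
      _ = (∑' g, |a g|) * ∑' g, |b g| := by
          rw [← tsum_mul_right]
          refine tsum_congr fun s => ?_
          rw [tsum_mul_left]
          congr 1
          exact (Equiv.mulLeft s⁻¹).tsum_eq fun g => |b g|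

theorem ofGroupRing_add (a b : MonoidAlgebra ℤ Γ) :
    ofGroupRing (a + b) = ofGroupRing a + ofGroupRing b :=
  ext fun g => by simp [ofGroupRing_apply]

theorem isUnit_natCast {N : ℕ} (hN : 0 < N) : IsUnit (N : EllOne Γ) := by
  have h : (N : EllOne Γ) * (((N : ℝ)⁻¹) • 1) = 1 := by
    rw [← nsmul_eq_mul, ← Nat.cast_smul_eq_nsmul ℝ, smul_smul, mul_inv_cancel₀, one_smul]
    positivity
  refine ⟨⟨N, _, h, ?_⟩, rfl⟩
  rw [← (Nat.cast_commute N _).eq, h]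

/-- The inclusion of `(ℤΓ)ᵏ` into `ℓ¹(Γ)ᵏ`. -/
def ofGroupRingVec {k : ℕ} : (Fin k → MonoidAlgebra ℤ Γ) →+ (Fin k → EllOne Γ) :=
  AddMonoidHom.mk' (fun m j => ofGroupRing (m j)) fun _ _ =>
    funext fun _ => ofGroupRing_add _ _

/-- The vectors of `ℓ¹(Γ)ᵏ` with a positive integral multiple in `J`. -/
def rationalHull {k : ℕ} (J : AddSubgroup (Fin k → MonoidAlgebra ℤ Γ)) :
    AddSubgroup (Fin k → EllOne Γ) where
  carrier := {v | ∃ N : ℕ, 0 < N ∧ ∃ m ∈ J, N • v = ofGroupRingVec m}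
  zero_mem' := ⟨1, one_pos, 0, J.zero_mem, by simp⟩
  add_mem' := by
    rintro v w ⟨N, hN, m, hm, hv⟩ ⟨N', hN', m', hm', hw⟩
    refine ⟨N * N', by positivity, N' • m + N • m',
      J.add_mem (J.nsmul_mem hm _) (J.nsmul_mem hm' _), ?_⟩
    rw [map_add, map_nsmul, map_nsmul, ← hv, ← hw, smul_add, smul_smul, smul_smul, mul_comm N']
  neg_mem' := by
    rintro v ⟨N, hN, m, hm, hv⟩
    exact ⟨N, hN, -m, J.neg_mem hm, by rw [map_neg, ← hv, smul_neg]⟩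

/-- The closure of `rationalHull J`; being stable under rational, hence real, scalars it is a
subspace. -/
def closedHull {k : ℕ} (J : AddSubgroup (Fin k → MonoidAlgebra ℤ Γ)) :
    Submodule ℝ (Fin k → EllOne Γ) where
  __ := (rationalHull J).topologicalClosure
  smul_mem' r v hv := by
    change r • v ∈ closure (rationalHull J : Set (Fin k → EllOne Γ))
    change v ∈ closure (rationalHull J : Set (Fin k → EllOne Γ)) at hv
    refine Rat.denseRange_cast.induction_on (p := fun r : ℝ => r • v ∈ closure _) r ?_ fun q => ?_
    · exact isClosed_closure.preimage (f := fun r : ℝ => r • v) (by fun_prop)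
    · refine map_mem_closure (f := fun v : Fin k → EllOne Γ => (q : ℝ) • v) (by fun_prop) hv ?_
      rintro w ⟨N, hN, m, hm, hw⟩
      refine ⟨q.den * N, Nat.mul_pos q.den_pos hN, q.num • m, J.zsmul_mem hm _, ?_⟩
      rw [map_zsmul, ← hw, ← Nat.cast_smul_eq_nsmul ℝ, ← Nat.cast_smul_eq_nsmul ℝ,
        ← Int.cast_smul_eq_zsmul ℝ, smul_smul, smul_smul]
      congr 1
      have : (q.den : ℝ) * q = q.num := by exact_mod_cast Rat.den_mul_eq_num q
      push_cast
      linear_combination (N : ℝ) * this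

/-- If no non-zero bounded function is orthogonal to `J`, then the real span of `J` is dense in
`ℓ¹(Γ)ᵏ`, by the Hahn–Banach theorem. -/
theorem closedHull_eq_top {k : ℕ} (J : AddSubgroup (Fin k → MonoidAlgebra ℤ Γ))
    (hJ : ∀ x : Γ → Fin k → ℝ, (∃ C, ∀ s j, |x s j| ≤ C) →
      (∀ m ∈ J, ∑ j, (m j).coeff.sum (fun s n => (n : ℝ) * x s j) = 0) → x = 0)
    (v : Fin k → EllOne Γ) : v ∈ closedHull J := by
  classical
  by_contra hv
  obtain ⟨f, u, hfv, hfu⟩ := geometric_hahn_banach_point_closed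
    (closedHull J).convex (t := (closedHull J : Set (Fin k → EllOne Γ))) isClosed_closure hv
  have hu : u < 0 := by simpa using hfu 0 (closedHull J).zero_mem
  have hf : ∀ w ∈ closedHull J, f w = 0 := fun w hw => by
    by_contra hne
    have := hfu _ ((closedHull J).smul_mem (u / f w) hw)
    rw [map_smul, smul_eq_mul, div_mul_cancel₀ _ hne] at this
    exact lt_irrefl _ this
  let x : Γ → Fin k → ℝ := fun s j => f (Pi.single j (single s 1))
  have hsum : ∀ (a : EllOne Γ) (j : Fin k),
      HasSum (fun s => a s * x s j) (f (Pi.single j a)) := fun a j => by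
    let L : EllOne Γ →L[ℝ] ℝ := f.comp (ContinuousLinearMap.single ℝ (fun _ => EllOne Γ) j)
    have h := (hasSum_single a).map L L.continuous
    have he : ∀ s, single s (a s) = a s • single s (1 : ℝ) := fun s => ext fun g => by
      rw [smul_apply, single_apply, single_apply]
      by_cases hg : g = s
      · subst hg; simp
      · simp [Pi.single_eq_of_ne hg]
    have hL : (L ∘ fun s => single s (a s)) = fun s => a s * x s j := by
      funext s
      rw [Function.comp_apply, he, map_smul]
      rfl
    rw [hL] at h
    exact h
  have hfsum : ∀ w, f w = ∑ j, f (Pi.single j (w j)) := fun w => by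
    conv_lhs => rw [← Finset.univ_sum_single w]
    exact map_sum f _ _
  have hx0 : x = 0 := by
    refine hJ x ⟨‖f‖, fun s j => ?_⟩ fun m hm => ?_
    · have := f.le_opNorm (Pi.single j (single s 1))
      rwa [Pi.norm_single, norm_single, abs_one, mul_one, Real.norm_eq_abs] at this
    · rw [← hf (ofGroupRingVec m) (subset_closure ⟨1, one_pos, m, hm, one_smul _ _⟩), hfsum]
      refine Finset.sum_congr rfl fun j _ => ?_
      rw [← (hsum (ofGroupRingVec m j) j).tsum_eq, Finsupp.sum]
      refine (tsum_eq_sum fun s hs => ?_).symm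
      change (((m j).coeff s : ℤ) : ℝ) * x s j = 0
      simp [Finsupp.notMem_support_iff.mp hs]
  have hfv0 : f v = 0 := by
    rw [hfsum]
    refine Finset.sum_eq_zero fun j _ => ?_
    rw [← (hsum (v j) j).tsum_eq, hx0]
    simp
  linarith

/-- If no non-zero bounded function is orthogonal to `J`, then there is a matrix with rows
in `J` that is invertible over `ℓ¹(Γ)`: rows of the identity matrix are approximated by rational
multiples of elements of `J`, and the denominators are cleared. -/
theorem exists_isUnit_map_ofGroupRing {k : ℕ} (J : AddSubgroup (Fin k → MonoidAlgebra ℤ Γ))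
    (hJ : ∀ x : Γ → Fin k → ℝ, (∃ C, ∀ s j, |x s j| ≤ C) →
      (∀ m ∈ J, ∑ j, (m j).coeff.sum (fun s n => (n : ℝ) * x s j) = 0) → x = 0) :
    ∃ A : Matrix (Fin k) (Fin k) (MonoidAlgebra ℤ Γ),
      (∀ i, A i ∈ J) ∧ IsUnit (A.map ofGroupRing) := by
  have happrox : ∀ i : Fin k, ∃ v ∈ rationalHull J,
      dist ((1 : Matrix (Fin k) (Fin k) (EllOne Γ)) i) v < 1 / (k + 1 : ℝ) := fun i =>
    Metric.mem_closure_iff.mp (closedHull_eq_top J hJ _) _ (by positivity)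
  choose v hv hdist using happrox
  choose N hN m hm hNv using hv
  refine ⟨Matrix.of m, hm, ?_⟩
  have hC : IsUnit (Matrix.of v) := by
    refine Matrix.isUnit_of_norm_sub_lt _ fun i j => ?_
    refine le_trans ?_ (hdist i).le
    rw [dist_eq_norm]
    exact norm_le_pi_norm ((1 : Matrix (Fin k) (Fin k) (EllOne Γ)) i - v i) j
  have hD : IsUnit (Matrix.diagonal fun i => (N i : EllOne Γ)) :=
    (Pi.isUnit_iff.mpr fun i => isUnit_natCast (hN i)).map
      (Matrix.diagonalRingHom (Fin k) (EllOne Γ))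
  have : (Matrix.of m).map ofGroupRing =
      Matrix.diagonal (fun i => (N i : EllOne Γ)) * Matrix.of v := by
    ext1 i j
    rw [Matrix.diagonal_mul, ← nsmul_eq_mul]
    exact (congrFun (hNv i) j).symm
  rw [this]
  exact hD.mul hC

end EllOne

/-! ### The action of `ℓ¹(Γ)` on bounded functions -/

section BoundedAction

variable {Γ : Type*} [Group Γ] {k : ℕ}

namespace EllOne

theorem summable_mul_of_abs_le (a : EllOne Γ) {y : Γ → ℝ} {C : ℝ} (hy : ∀ g, |y g| ≤ C) (g : Γ) :
    Summable fun s => a s * y (g * s) := by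
  refine Summable.of_norm_bounded (a.summable_abs.mul_right C) fun s => ?_
  rw [Real.norm_eq_abs, abs_mul]
  exact mul_le_mul_of_nonneg_left (hy _) (abs_nonneg _)

/-- The action of `ℓ¹(Γ)` on the bounded functions on `Γ`, `(a • y)(g) = ∑ s, a(s) y(g s)`. -/
def act (a : EllOne Γ) (y : Γ → ℝ) (g : Γ) : ℝ := ∑' s, a s * y (g * s)

theorem abs_act_le (a : EllOne Γ) {y : Γ → ℝ} {C : ℝ} (hy : ∀ g, |y g| ≤ C) (g : Γ) :
    |act a y g| ≤ ‖a‖ * C := by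
  rw [norm_eq_tsum, ← tsum_mul_right, ← Real.norm_eq_abs]
  refine tsum_of_norm_bounded (a.summable_abs.mul_right C).hasSum fun s => ?_
  rw [Real.norm_eq_abs, abs_mul]
  exact mul_le_mul_of_nonneg_left (hy _) (abs_nonneg _)

theorem act_one (y : Γ → ℝ) : act (1 : EllOne Γ) y = y := by
  funext g
  rw [act, tsum_eq_single 1]
  · simp [one_apply]
  · intro s hs
    simp [one_apply, hs]

theorem act_zero (y : Γ → ℝ) : act (0 : EllOne Γ) y = 0 := by
  funext g
  simp [act]

theorem act_sum {ι : Type*} (F : Finset ι) (a : ι → EllOne Γ) {y : Γ → ℝ} {C : ℝ}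
    (hy : ∀ g, |y g| ≤ C) (g : Γ) : act (∑ i ∈ F, a i) y g = ∑ i ∈ F, act (a i) y g := by
  classical
  induction F using Finset.induction_on with
  | empty => simp [act_zero]
  | insert i F hi ih =>
    rw [Finset.sum_insert hi, Finset.sum_insert hi, ← ih, act, act, act,
      ← (summable_mul_of_abs_le _ hy g).tsum_add (summable_mul_of_abs_le _ hy g)]
    simp only [add_apply, add_mul]

theorem act_finset_sum_right {ι : Type*} (F : Finset ι) (a : EllOne Γ) {y : ι → Γ → ℝ} {C : ℝ}
    (hy : ∀ i g, |y i g| ≤ C) (g : Γ) :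
    act a (fun h => ∑ i ∈ F, y i h) g = ∑ i ∈ F, act a (y i) g := by
  simp only [act, Finset.mul_sum]
  exact Summable.tsum_finsetSum fun i _ => summable_mul_of_abs_le a (hy i) g

theorem act_sub (a : EllOne Γ) {y z : Γ → ℝ} {C D : ℝ} (hy : ∀ g, |y g| ≤ C)
    (hz : ∀ g, |z g| ≤ D) (g : Γ) : act a (fun h => y h - z h) g = act a y g - act a z g := by
  simp only [act, mul_sub]
  exact (summable_mul_of_abs_le a hy g).tsum_sub (summable_mul_of_abs_le a hz g)

theorem act_mul (a b : EllOne Γ) {y : Γ → ℝ} {C : ℝ} (hy : ∀ g, |y g| ≤ C) (g : Γ) :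
    act (a * b) y g = act a (act b y) g := by
  have hs : Summable fun p : Γ × Γ => a p.1 * b (p.1⁻¹ * p.2) * y (g * p.2) := by
    refine Summable.of_norm_bounded ((summable_conv_abs a b).mul_right C) fun p => ?_
    rw [Real.norm_eq_abs, abs_mul, abs_mul]
    exact mul_le_mul_of_nonneg_left (hy _) (by positivity)
  have e1 : act (a * b) y g = ∑' t, ∑' s, a s * b (s⁻¹ * t) * y (g * t) :=
    tsum_congr fun t => by rw [mul_apply, tsum_mul_right]
  have e2 : act a (act b y) g = ∑' s, ∑' t, a s * b (s⁻¹ * t) * y (g * t) := by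
    refine tsum_congr fun s => ?_
    rw [act, ← tsum_mul_left,
      ← (Equiv.mulLeft s).tsum_eq fun t => a s * b (s⁻¹ * t) * y (g * t)]
    refine tsum_congr fun t => ?_
    simp [mul_assoc]
  rw [e1, e2]
  exact Summable.tsum_comm hs

end EllOne

/-- The action of matrices over `ℓ¹(Γ)` on bounded functions from `Γ` to `ℝᵏ`,
`(M x)(g)_i = ∑ j, ∑ s, M_ij(s) x(g s)_j`. -/
def matrixAct (M : Matrix (Fin k) (Fin k) (EllOne Γ)) (x : Γ → Fin k → ℝ) : Γ → Fin k → ℝ :=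
  fun g i => ∑ j, EllOne.act (M i j) (fun h => x h j) g

/-- The entrywise `ℓ¹`-norm of a matrix over `ℓ¹(Γ)`, a bound for its action on bounded
functions. -/
def matrixBound (M : Matrix (Fin k) (Fin k) (EllOne Γ)) : ℝ := ∑ i, ∑ j, ‖M i j‖

theorem matrixBound_nonneg (M : Matrix (Fin k) (Fin k) (EllOne Γ)) : 0 ≤ matrixBound M :=
  Finset.sum_nonneg fun _ _ => Finset.sum_nonneg fun _ _ => norm_nonneg _

theorem sum_norm_le_matrixBound (M : Matrix (Fin k) (Fin k) (EllOne Γ)) (i : Fin k) :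
    ∑ j, ‖M i j‖ ≤ matrixBound M :=
  Finset.single_le_sum (f := fun i => ∑ j, ‖M i j‖)
    (fun _ _ => Finset.sum_nonneg fun _ _ => norm_nonneg _) (Finset.mem_univ i)

variable (M N : Matrix (Fin k) (Fin k) (EllOne Γ)) {x y : Γ → Fin k → ℝ} {C D : ℝ}

theorem abs_matrixAct_le (hx : ∀ g j, |x g j| ≤ C) (g : Γ) (i : Fin k) :
    |matrixAct M x g i| ≤ matrixBound M * C := by
  have hC : 0 ≤ C := (abs_nonneg _).trans (hx g i)
  calc |matrixAct M x g i| ≤ ∑ j, |EllOne.act (M i j) (fun h => x h j) g| :=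
        Finset.abs_sum_le_sum_abs _ _
    _ ≤ ∑ j, ‖M i j‖ * C :=
        Finset.sum_le_sum fun j _ => EllOne.abs_act_le _ (fun h => hx h j) g
    _ ≤ matrixBound M * C := by
        rw [← Finset.sum_mul]
        exact mul_le_mul_of_nonneg_right (sum_norm_le_matrixBound M i) hC

theorem matrixAct_one (x : Γ → Fin k → ℝ) : matrixAct 1 x = x := by
  funext g i
  rw [matrixAct, Finset.sum_eq_single i]
  · rw [Matrix.one_apply_eq, EllOne.act_one]
  · intro j _ hj
    rw [Matrix.one_apply_ne hj.symm, EllOne.act_zero]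
    rfl
  · simp

/-- Bounded functions form a left module over the matrices, so an inverse over `ℓ¹(Γ)` inverts the
action. -/
theorem matrixAct_mul (hx : ∀ g j, |x g j| ≤ C) :
    matrixAct (M * N) x = matrixAct M (matrixAct N x) := by
  funext g i
  have hC : 0 ≤ C := (abs_nonneg _).trans (hx g i)
  have hN : ∀ l j h, |EllOne.act (N j l) (fun h => x h l) h| ≤ matrixBound N * C := fun l j h => by
    refine (EllOne.abs_act_le _ (fun h => hx h l) h).trans (mul_le_mul_of_nonneg_right ?_ hC)
    exact (Finset.single_le_sum (f := fun l => ‖N j l‖) (fun _ _ => norm_nonneg _)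
      (Finset.mem_univ l)).trans (sum_norm_le_matrixBound N j)
  simp only [matrixAct, Matrix.mul_apply]
  calc ∑ l, EllOne.act (∑ j, M i j * N j l) (fun h => x h l) g
      = ∑ l, ∑ j, EllOne.act (M i j) (EllOne.act (N j l) fun h => x h l) g := by
        refine Finset.sum_congr rfl fun l _ => ?_
        rw [EllOne.act_sum _ _ (fun h => hx h l)]
        exact Finset.sum_congr rfl fun j _ => EllOne.act_mul _ _ (fun h => hx h l) g
    _ = ∑ j, ∑ l, EllOne.act (M i j) (EllOne.act (N j l) fun h => x h l) g := Finset.sum_comm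
    _ = _ := Finset.sum_congr rfl fun j _ =>
        (EllOne.act_finset_sum_right _ _ (fun l h => hN l j h) g).symm

theorem matrixAct_sub (hx : ∀ g j, |x g j| ≤ C) (hy : ∀ g j, |y g j| ≤ D) :
    matrixAct M (x - y) = matrixAct M x - matrixAct M y := by
  funext g i
  simp only [matrixAct, Pi.sub_apply]
  rw [← Finset.sum_sub_distrib]
  exact Finset.sum_congr rfl fun j _ =>
    EllOne.act_sub _ (fun h => hx h j) (fun h => hy h j) g

theorem UnitAddCircle.coe_sum {ι : Type*} (F : Finset ι) (f : ι → ℝ) :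
    ((∑ i ∈ F, f i : ℝ) : UnitAddCircle) = ∑ i ∈ F, (f i : UnitAddCircle) :=
  map_sum (QuotientAddGroup.mk' (AddSubgroup.zmultiples (1 : ℝ))) f F

/-- For an integral matrix, the action on bounded real functions lifts the one on circle-valued
functions whose kernel is `X_A`. -/
theorem coe_matrixAct (A : Matrix (Fin k) (Fin k) (MonoidAlgebra ℤ Γ)) (x : Γ → Fin k → ℝ) (g : Γ)
    (i : Fin k) :
    ((matrixAct (A.map EllOne.ofGroupRing) x g i : ℝ) : UnitAddCircle) =
      ∑ j, (A i j).coeff.sum fun s n => n • (x (g * s) j : UnitAddCircle) := by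
  rw [matrixAct, UnitAddCircle.coe_sum]
  refine Finset.sum_congr rfl fun j _ => ?_
  rw [EllOne.act, tsum_eq_sum (s := (A i j).coeff.support), UnitAddCircle.coe_sum, Finsupp.sum]
  · refine Finset.sum_congr rfl fun s _ => ?_
    rw [Matrix.map_apply, EllOne.ofGroupRing_apply, ← zsmul_eq_mul, AddCircle.coe_zsmul]
  · intro s hs
    rw [Matrix.map_apply, EllOne.ofGroupRing_apply, Finsupp.notMem_support_iff.mp hs]
    simp

/-- The circle-valued combinations defining `X_A` are bounded by the same constant. -/
theorem norm_sum_coeff_le (A : Matrix (Fin k) (Fin k) (MonoidAlgebra ℤ Γ))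
    (t : Γ → Fin k → UnitAddCircle) (i : Fin k)
    (ht : ∀ j, ∀ s ∈ (A i j).coeff.support, ‖t s j‖ ≤ C) (hC : 0 ≤ C) :
    ‖∑ j, (A i j).coeff.sum fun s n => n • t s j‖ ≤
      matrixBound (A.map EllOne.ofGroupRing) * C := by
  calc _ ≤ ∑ j, ‖(A i j).coeff.sum fun s n => n • t s j‖ := norm_sum_le _ _
    _ ≤ ∑ j, ‖A.map EllOne.ofGroupRing i j‖ * C := by
        refine Finset.sum_le_sum fun j _ => ?_
        rw [EllOne.norm_eq_tsum, tsum_eq_sum (s := (A i j).coeff.support), Finset.sum_mul]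
        · refine (norm_sum_le _ _).trans (Finset.sum_le_sum fun s hs => ?_)
          refine (norm_zsmul_le _ _).trans ?_
          rw [Int.norm_eq_abs]
          exact mul_le_mul_of_nonneg_left (ht j s hs) (abs_nonneg _)
        · intro s hs
          rw [Matrix.map_apply, EllOne.ofGroupRing_apply, Finsupp.notMem_support_iff.mp hs]
          simp
    _ ≤ _ := by
        rw [← Finset.sum_mul]
        exact mul_le_mul_of_nonneg_right (sum_norm_le_matrixBound _ i) hC

end BoundedAction

/-! ### Expansiveness and pseudo-orbit tracing of `X_A` -/

section XADynamics

/-- A neighbourhood of `0` in `((ℝ/ℤ)ᵏ)^Γ` constrains only finitely many coordinates. -/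
theorem exists_finset_forall_norm_lt_mem {Γ : Type*} {k : ℕ} {U : Set (Γ → Fin k → UnitAddCircle)}
    (hU : U ∈ 𝓝 0) :
    ∃ F : Finset Γ, ∃ η : ℝ, 0 < η ∧
      ∀ x : Γ → Fin k → UnitAddCircle, (∀ h ∈ F, ∀ j, ‖x h j‖ < η) → x ∈ U := by
  classical
  rw [nhds_pi, Filter.mem_pi'] at hU
  obtain ⟨F, t, ht, hF⟩ := hU
  have hη : ∀ h, ∃ η : ℝ, 0 < η ∧ Metric.ball (0 : Fin k → UnitAddCircle) η ⊆ t h := fun h =>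
    Metric.mem_nhds_iff.mp (ht h)
  choose η hη0 hηt using hη
  obtain ⟨η', hη'0, hη'⟩ : ∃ η' : ℝ, 0 < η' ∧ ∀ h ∈ F, η' ≤ η h := by
    have := Filter.eventually_all_finset F |>.mpr fun h _ =>
      (Ioc_mem_nhdsGT (hη0 h) : Set.Ioc 0 (η h) ∈ 𝓝[>] (0 : ℝ))
    obtain ⟨r, hr, hr0⟩ := (this.and self_mem_nhdsWithin).exists
    exact ⟨r, hr0, fun h hh => (hr h hh).2⟩
  refine ⟨F, η', hη'0, fun x hx => hF fun h hh => hηt h ?_⟩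
  rw [mem_ball_zero_iff, pi_norm_lt_iff (hη0 h)]
  exact fun j => (hx h hh j).trans_le (hη' h hh)

variable {Γ : Type*} [Group Γ] {k : ℕ} (A : Matrix (Fin k) (Fin k) (MonoidAlgebra ℤ Γ))

theorem XA.smul_apply (g : Γ) (x : XA A) (h : Γ) : (g • x).1 h = x.1 (g⁻¹ * h) := rfl

/-- A metric inducing the topology of `X_A` induces its uniform structure, by compactness. -/
theorem XA.hasBasis_uniformity (m : MetricSpace (XA A))
    (hm : m.toUniformSpace.toTopologicalSpace =
      (instTopologicalSpaceSubtype : TopologicalSpace (XA A))) :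
    (@uniformity (XA A) instUniformSpaceSubtype).HasBasis (fun ε : ℝ => 0 < ε)
      fun ε => {p | m.dist p.1 p.2 < ε} := by
  have h : m.toUniformSpace = (instUniformSpaceSubtype : UniformSpace (XA A)) :=
    @unique_uniformity_of_compact (XA A) instTopologicalSpaceSubtype (XA.instCompactSpace A) _ _
      hm rfl
  rw [← h]
  exact @Metric.uniformity_basis_dist (XA A) m.toPseudoMetricSpace

/-- The real lift of a point of `X_A` with small coordinates is mapped by `A` to a small integral
function, that is, to zero. -/
theorem XA.exists_forall_norm_le_imp_eq_zero (hA : IsUnit (A.map EllOne.ofGroupRing)) :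
    ∃ η : ℝ, 0 < η ∧ ∀ x ∈ XA A, (∀ g j, ‖x g j‖ ≤ η) → x = 0 := by
  obtain ⟨u, hu⟩ := hA
  set K := matrixBound (A.map EllOne.ofGroupRing)
  have hK : 0 ≤ K := matrixBound_nonneg _
  have hη : 0 < 1 / (K + 1) := by positivity
  refine ⟨1 / (K + 1), hη, fun x hx hxη => ?_⟩
  choose y hyx hy using fun g j => UnitAddCircle.exists_coe_eq (x g j)
  have hyη : ∀ g j, |y g j| ≤ 1 / (K + 1) := fun g j => (hy g j).trans_le (hxη g j)
  have hAy : matrixAct (A.map EllOne.ofGroupRing) y = 0 := by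
    funext g i
    have h1 : ((matrixAct (A.map EllOne.ofGroupRing) y g i : ℝ) : UnitAddCircle) = 0 := by
      rw [coe_matrixAct]
      simp only [hyx]
      exact hx g i
    obtain ⟨n, hn⟩ := (AddCircle.coe_eq_zero_iff 1).mp h1
    have h2 := abs_matrixAct_le (A.map EllOne.ofGroupRing) hyη g i
    have h3 : K * (1 / (K + 1)) < 1 := by
      rw [mul_one_div, div_lt_one (by positivity)]
      linarith
    rw [← hn, zsmul_one] at h2
    have h4 : |(n : ℝ)| < 1 := h2.trans_lt h3
    have h5 : n = 0 := by
      rw [← Int.abs_lt_one_iff]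
      exact_mod_cast h4
    rw [← hn, h5]
    simp
  have hy0 : y = 0 := by
    rw [← matrixAct_one y, ← Units.inv_mul u, matrixAct_mul _ _ hyη, hu, hAy]
    funext g i
    simp [matrixAct, EllOne.act]
  funext g j
  rw [← hyx, hy0]
  simp

variable {A} {d : XA A → XA A → ℝ}

theorem XA.exists_norm_lt_of_dist_lt
    (hd : (𝓤 (XA A)).HasBasis (fun ε : ℝ => 0 < ε) fun ε => {p | d p.1 p.2 < ε})
    {η : ℝ} (hη : 0 < η) :
    ∃ δ : ℝ, 0 < δ ∧ ∀ x y : XA A, d x y < δ → ∀ j, ‖x.1 1 j - y.1 1 j‖ < η := by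
  have hval : UniformContinuous fun x : XA A => x.1 := uniformContinuous_subtype_val
  have huc : UniformContinuous fun x : XA A => x.1 1 := uniformContinuous_pi.mp hval 1
  have hev : ∀ᶠ p : XA A × XA A in 𝓤 (XA A), dist (p.1.1 1) (p.2.1 1) < η :=
    huc.eventually (Metric.dist_mem_uniformity hη)
  obtain ⟨δ, hδ, h⟩ := hd.eventually_iff.mp hev
  refine ⟨δ, hδ, fun x y hxy j => ?_⟩
  have h1 := @h (x, y) hxy
  rw [dist_eq_norm] at h1
  exact (norm_le_pi_norm (x.1 1 - y.1 1) j).trans_lt h1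

theorem XA.exists_dist_lt_of_norm_lt
    (hd : (𝓤 (XA A)).HasBasis (fun ε : ℝ => 0 < ε) fun ε => {p | d p.1 p.2 < ε})
    {ε : ℝ} (hε : 0 < ε) :
    ∃ F : Finset Γ, ∃ η : ℝ, 0 < η ∧ ∀ x y : XA A,
      (∀ h ∈ F, ∀ j, ‖x.1 h j - y.1 h j‖ < η) → d x y < ε := by
  have h1 := hd.mem_of_mem hε
  rw [uniformity_subtype, Filter.mem_comap] at h1
  obtain ⟨V, hV, hVε⟩ := h1
  rw [uniformity_eq_comap_nhds_zero_swapped, Filter.mem_comap] at hV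
  obtain ⟨U, hU, hUV⟩ := hV
  obtain ⟨F, η, hη, hF⟩ := exists_finset_forall_norm_lt_mem hU
  refine ⟨F, η, hη, fun x y hxy => ?_⟩
  have h2 : (x, y) ∈ {p : XA A × XA A | d p.1 p.2 < ε} := hVε (hUV (hF _ hxy))
  exact h2

theorem XA.isExpansive
    (hd : (𝓤 (XA A)).HasBasis (fun ε : ℝ => 0 < ε) fun ε => {p | d p.1 p.2 < ε})
    (hA : IsUnit (A.map EllOne.ofGroupRing)) :
    IsExpansive Γ d := by
  obtain ⟨η, hη, hXA⟩ := XA.exists_forall_norm_le_imp_eq_zero A hA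
  obtain ⟨δ, hδ, hdist⟩ := XA.exists_norm_lt_of_dist_lt hd hη
  refine ⟨δ / 2, by positivity, fun x y hxy => ?_⟩
  by_contra! H
  refine hxy (sub_eq_zero.mp (Subtype.ext (hXA _ (x - y).2 fun g j => ?_)))
  have := hdist (g⁻¹ • x) (g⁻¹ • y) ((H g⁻¹).trans_lt (by linarith)) j
  rw [XA.smul_apply, XA.smul_apply, inv_inv, mul_one] at this
  exact this.le

/-- A pseudo-orbit is read off at the identity as a function `y`; its real lift is mapped by `A`
close to an integral function, whose preimage under `A` is the lift of a tracing point. -/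
theorem XA.hasPseudoOrbitTracing
    (hd : (𝓤 (XA A)).HasBasis (fun ε : ℝ => 0 < ε) fun ε => {p | d p.1 p.2 < ε})
    (hA : IsUnit (A.map EllOne.ofGroupRing)) :
    HasPseudoOrbitTracing Γ d := by
  classical
  intro ε hε
  obtain ⟨u, hu⟩ := hA
  obtain ⟨F, η, hη, hF⟩ := XA.exists_dist_lt_of_norm_lt hd hε
  set KA := matrixBound (A.map EllOne.ofGroupRing)
  set B : Matrix (Fin k) (Fin k) (EllOne Γ) := ↑u⁻¹
  set KB := matrixBound B
  have hKA : 0 ≤ KA := matrixBound_nonneg _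
  have hKB : 0 ≤ KB := matrixBound_nonneg _
  -- An error `τ` in the pseudo-orbit becomes an error `KB * KA * τ` in the traced point.
  obtain ⟨τ, hτ, hτη, hKτ⟩ : ∃ τ : ℝ, 0 < τ ∧ τ ≤ η / 2 ∧ KB * (KA * τ) < η / 2 := by
    refine ⟨η / 2 / (KB * KA + 1), by positivity, div_le_self (by positivity) ?_, ?_⟩
    · nlinarith [mul_nonneg hKB hKA]
    · rw [← mul_assoc, ← mul_div_assoc, div_lt_iff₀ (by positivity)]
      nlinarith [mul_nonneg hKB hKA]
  obtain ⟨δ, hδ, hdist⟩ := XA.exists_norm_lt_of_dist_lt hd hτ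
  let S : Finset Γ := (F ∪ Finset.univ.biUnion fun i => Finset.univ.biUnion fun j =>
    (A i j).coeff.support).image fun s => s⁻¹
  refine ⟨δ, hδ, S, fun p hp => ?_⟩
  have hclose : ∀ s, s⁻¹ ∈ S → ∀ g j, ‖(p g).1 s j - (p (s⁻¹ * g)).1 1 j‖ < τ := fun s hs g j => by
    have := hdist _ _ (hp s⁻¹ hs g) j
    rwa [XA.smul_apply, inv_inv, mul_one] at this
  choose y hyp hy using fun g j => UnitAddCircle.exists_coe_eq ((p g⁻¹).1 1 j)
  have hyb : ∀ g j, |y g j| ≤ 1 / 2 := fun g j => by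
    rw [hy]
    simpa using AddCircle.norm_le_half_period (1 : ℝ) one_ne_zero (x := (p g⁻¹).1 1 j)
  choose e hez he using fun g i =>
    UnitAddCircle.exists_coe_eq (matrixAct (A.map EllOne.ofGroupRing) y g i : UnitAddCircle)
  have heb : ∀ g i, |e g i| ≤ KA * τ := fun g i => by
    rw [he, coe_matrixAct]
    have h0 := (p g⁻¹).2 1 i
    simp only [one_mul] at h0
    rw [← sub_zero (Finset.sum _ _), ← h0, ← Finset.sum_sub_distrib]
    simp only [Finsupp.sum, ← Finset.sum_sub_distrib, ← smul_sub]
    refine norm_sum_coeff_le A (fun s j => (y (g * s) j : UnitAddCircle) - (p g⁻¹).1 s j) i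
      (fun j s hs => ?_) hτ.le
    rw [hyp, norm_sub_rev, mul_inv_rev]
    refine (hclose s (Finset.mem_image_of_mem _ (Finset.mem_union_right _ ?_)) g⁻¹ j).le
    exact Finset.mem_biUnion.mpr ⟨i, Finset.mem_univ _, Finset.mem_biUnion.mpr
      ⟨j, Finset.mem_univ _, hs⟩⟩
  have hzb : ∀ g i, |(matrixAct (A.map EllOne.ofGroupRing) y - e) g i| ≤
      KA * (1 / 2) + KA * τ := fun g i =>
    (abs_sub _ _).trans (add_le_add (abs_matrixAct_le _ hyb g i) (heb g i))
  set w := matrixAct B (matrixAct (A.map EllOne.ofGroupRing) y - e) with hw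
  have hAw : matrixAct (A.map EllOne.ofGroupRing) w =
      matrixAct (A.map EllOne.ofGroupRing) y - e := by
    rw [hw, ← matrixAct_mul _ _ hzb, ← hu, Units.mul_inv, matrixAct_one]
  have hwy : ∀ g j, |w g j - y g j| < η / 2 := fun g j => by
    have h1 : w = y - matrixAct B e := by
      rw [hw, matrixAct_sub B (fun g i => abs_matrixAct_le _ hyb g i) heb,
        ← matrixAct_mul _ _ hyb, ← hu, Units.inv_mul, matrixAct_one]
    rw [h1, Pi.sub_apply, Pi.sub_apply, sub_sub_cancel_left, abs_neg]
    exact (abs_matrixAct_le B heb g j).trans_lt hKτ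
  refine ⟨⟨fun g j => (w g j : UnitAddCircle), fun g i => ?_⟩, fun g => hF _ _ fun h hh j => ?_⟩
  · rw [← coe_matrixAct, hAw, Pi.sub_apply, Pi.sub_apply, AddCircle.coe_sub, hez, sub_self]
  · rw [XA.smul_apply]
    have h1 : ‖(w (g⁻¹ * h) j : UnitAddCircle) - (p (h⁻¹ * g)).1 1 j‖ < η / 2 := by
      have := hyp (g⁻¹ * h) j
      rw [mul_inv_rev, inv_inv] at this
      rw [← this, ← AddCircle.coe_sub]
      exact (UnitAddCircle.norm_coe_le _).trans_lt (hwy _ _)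
    have h2 := hclose h (Finset.mem_image_of_mem _ (Finset.mem_union_left _ hh)) g j
    rw [norm_sub_rev] at h2
    refine (norm_sub_le_norm_sub_add_norm_sub _ ((p (h⁻¹ * g)).1 1 j) _).trans_lt ?_
    linarith

end XADynamics

/-! ### Embedding an expansive action into some `X_A` -/

section Embedding

/-- In a compact abelian group, the common kernel of finitely many suitable characters lies in a
given ball around `0`. -/
theorem exists_characters_dist_lt {X : Type*} [MetricSpace X] [CompactSpace X] [AddCommGroup X]
    [IsTopologicalAddGroup X] {c : ℝ} (hc : 0 < c) :
    ∃ (k : ℕ) (χ : Fin k → X →+ UnitAddCircle), 0 < k ∧ (∀ j, Continuous (χ j)) ∧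
      ∀ x, (∀ j, χ j x = 0) → dist x 0 < c := by
  have hK : IsCompact {x : X | c ≤ dist x 0} :=
    (isClosed_le continuous_const (continuous_id.dist continuous_const)).isCompact
  obtain ⟨T, hT⟩ := hK.elim_finite_subcover
    (fun χ : {χ : X →+ UnitAddCircle // Continuous χ} => {x | χ.1 x ≠ 0})
    (fun χ => isOpen_ne.preimage χ.2) (fun x hx => by
      have hx0 : x ≠ 0 := by
        rintro rfl
        have : c ≤ dist (0 : X) 0 := hx
        rw [dist_self] at this
        linarith
      obtain ⟨χ, hχ, hχx⟩ := exists_addCircle_character_ne_zero hx0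
      exact Set.mem_iUnion.mpr ⟨⟨χ, hχ⟩, hχx⟩)
  -- The trivial character is added to make the number of characters positive.
  refine ⟨T.card + 1, Fin.cons 0 fun i => (T.equivFin.symm i).1.1, Nat.succ_pos _, fun j => ?_,
    fun x hx => ?_⟩
  · refine Fin.cases ?_ (fun i => ?_) j
    · exact continuous_const
    · exact (T.equivFin.symm i).1.2
  · by_contra! hcx
    obtain ⟨χ, hχT, hχx⟩ := Set.mem_iUnion₂.mp (hT hcx)
    have := hx (T.equivFin ⟨χ, hχT⟩).succ
    rw [Fin.cons_succ, Equiv.symm_apply_apply] at this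
    exact hχx this

theorem groupRingPairing_coe_smul {Γ : Type*} {k : ℕ} (t : ℝ) (x : Γ → Fin k → ℝ)
    (m : Fin k → MonoidAlgebra ℤ Γ) :
    groupRingPairing (fun s j => ((t * x s j : ℝ) : UnitAddCircle)) m =
      ((t * ∑ j, (m j).coeff.sum (fun s n => (n : ℝ) * x s j) : ℝ) : UnitAddCircle) := by
  rw [groupRingPairing, Finset.mul_sum, UnitAddCircle.coe_sum]
  refine Finset.sum_congr rfl fun j _ => ?_
  rw [Finsupp.sum, Finsupp.sum, Finset.mul_sum, UnitAddCircle.coe_sum]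
  refine Finset.sum_congr rfl fun s _ => ?_
  rw [← AddCircle.coe_zsmul, zsmul_eq_mul, mul_left_comm]

variable {Γ X : Type*} [Group Γ] [AddCommGroup X] [DistribMulAction Γ X] {k : ℕ}

/-- The orbit map `x ↦ (g ↦ (χ_j(g⁻¹ x))_j)` attached to characters `χ_j`. -/
def orbitMap (χ : Fin k → X →+ UnitAddCircle) : X →+ (Γ → Fin k → UnitAddCircle) :=
  AddMonoidHom.mk' (fun x g j => χ j (g⁻¹ • x)) fun x y => by
    funext g j
    simp [smul_add]

theorem orbitMap_smul (χ : Fin k → X →+ UnitAddCircle) (g : Γ) (x : X) (h : Γ) :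
    orbitMap χ (g • x) h = orbitMap χ x (g⁻¹ * h) := by
  funext j
  simp [orbitMap, mul_smul]

/-- The elements of `(ℤΓ)ᵏ` orthogonal to a subgroup of `((ℝ/ℤ)ᵏ)^Γ`. -/
def groupRingAnnihilator (Y : AddSubgroup (Γ → Fin k → UnitAddCircle)) :
    AddSubgroup (Fin k → MonoidAlgebra ℤ Γ) where
  carrier := {m | ∀ y ∈ Y, groupRingPairing y m = 0}
  zero_mem' y _ := by simp [groupRingPairing]
  add_mem' hm hm' y hy := by rw [groupRingPairing_add, hm y hy, hm' y hy, add_zero]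
  neg_mem' {m} hm y hy := by
    have h := groupRingPairing_add y m (-m)
    rw [add_neg_cancel, hm y hy, zero_add] at h
    rw [← h]
    simp [groupRingPairing]

variable [TopologicalSpace X] [ContinuousConstSMul Γ X]

theorem continuous_orbitMap {χ : Fin k → X →+ UnitAddCircle} (hχ : ∀ j, Continuous (χ j)) :
    Continuous (orbitMap (Γ := Γ) χ) :=
  continuous_pi fun g => continuous_pi fun j => (hχ j).comp (continuous_const_smul g⁻¹)

end Embedding

/-- A bounded function orthogonal to the annihilator of an expansive closed invariant subgroup of
`((ℝ/ℤ)ᵏ)^Γ` vanishes: its small multiples reduce modulo `ℤ` to points of the subgroup with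
uniformly small orbits. -/
theorem eq_zero_of_orthogonal_annihilator {Γ X : Type*} [Group Γ] [MetricSpace X] [CompactSpace X]
    [AddCommGroup X] [DistribMulAction Γ X] [ContinuousConstSMul Γ X] {k : ℕ}
    {χ : Fin k → X →+ UnitAddCircle} (hχ : ∀ j, Continuous (χ j))
    (hinj : Function.Injective (orbitMap (Γ := Γ) χ)) {c : ℝ} (hc : 0 < c)
    (hexp : ∀ x : X, (∀ g : Γ, dist (g • x) 0 < c) → x = 0) {x : Γ → Fin k → ℝ} {C : ℝ}
    (hx : ∀ s j, |x s j| ≤ C)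
    (hxm : ∀ m ∈ groupRingAnnihilator (orbitMap (Γ := Γ) χ).range,
      ∑ j, (m j).coeff.sum (fun s n => (n : ℝ) * x s j) = 0) : x = 0 := by
  have hemb := (continuous_orbitMap (Γ := Γ) hχ).isClosedEmbedding hinj
  have hball : Metric.ball (0 : X) c ∈ Filter.comap (orbitMap (Γ := Γ) χ) (𝓝 0) := by
    have h := hemb.isInducing.nhds_eq_comap (0 : X)
    rw [map_zero] at h
    rw [← h]
    exact Metric.ball_mem_nhds _ hc
  obtain ⟨U, hU, hUb⟩ := Filter.mem_comap.mp hball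
  obtain ⟨F, η, hη, hF⟩ := exists_finset_forall_norm_lt_mem hU
  obtain ⟨t, ht, htη, hth⟩ : ∃ t : ℝ, 0 < t ∧ t * |C| < η ∧ t * |C| ≤ 1 / 2 := by
    refine ⟨min η (1 / 2) / (|C| + 1), by positivity, ?_, ?_⟩
    · refine lt_of_lt_of_le ?_ (min_le_left η (1 / 2))
      rw [div_mul_eq_mul_div, div_lt_iff₀ (by positivity)]
      have : 0 < min η (1 / 2) := by positivity
      nlinarith
    · refine le_trans ?_ (min_le_right η (1 / 2))
      rw [div_mul_eq_mul_div, div_le_iff₀ (by positivity)]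
      have : 0 < min η (1 / 2) := by positivity
      nlinarith
  have habs : ∀ s j, |t * x s j| ≤ t * |C| := fun s j => by
    rw [abs_mul, abs_of_pos ht]
    exact mul_le_mul_of_nonneg_left ((hx s j).trans (le_abs_self C)) ht.le
  obtain ⟨z, hz⟩ : (fun s j => ((t * x s j : ℝ) : UnitAddCircle)) ∈
      (orbitMap (Γ := Γ) χ).range := by
    by_contra hy
    obtain ⟨m, hm, hmy⟩ := exists_groupRingPairing_ne_zero (orbitMap (Γ := Γ) χ).range
      hemb.isClosed_range hy
    rw [groupRingPairing_coe_smul, hxm m hm, mul_zero] at hmy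
    exact hmy rfl
  have hz0 : z = 0 := hexp z fun g => by
    refine hUb (hF _ fun h _ j => ?_)
    rw [orbitMap_smul, hz]
    exact (UnitAddCircle.norm_coe_le _).trans_lt ((habs _ j).trans_lt htη)
  funext s j
  have h1 : ((t * x s j : ℝ) : UnitAddCircle) = 0 := by
    rw [hz0, map_zero] at hz
    exact (congrFun (congrFun hz s) j).symm
  have h2 := UnitAddCircle.norm_coe_of_abs_le ((habs s j).trans hth)
  rw [h1, norm_zero, eq_comm, abs_eq_zero] at h2
  exact (mul_eq_zero.mp h2).resolve_left ht.ne'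

end

theorem mainTheorem6 {Γ X : Type*} [Group Γ] [Countable Γ]
    [MetricSpace X] [CompactSpace X] [AddCommGroup X] [IsTopologicalAddGroup X]
    [DistribMulAction Γ X] [ContinuousConstSMul Γ X]
    (hX : IsExpansive Γ (dist : X → X → ℝ)) :
    ∃ (k : ℕ) (A : Matrix (Fin k) (Fin k) (MonoidAlgebra ℤ Γ)),
      0 < k ∧
      IsUnit (A.map EllOne.ofGroupRing) ∧
      (∀ m : MetricSpace (XA A),
        m.toUniformSpace.toTopologicalSpace = (instTopologicalSpaceSubtype : TopologicalSpace (XA A)) →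
          IsExpansive Γ m.dist ∧ HasPseudoOrbitTracing Γ m.dist) ∧
      ∃ Φ : X →+[Γ] XA A, Continuous Φ ∧ Function.Injective Φ := by
  obtain ⟨c, hc, hexp⟩ := hX
  have hexp0 : ∀ x : X, (∀ g : Γ, dist (g • x) 0 < c) → x = 0 := fun x hx => by
    by_contra hx0
    obtain ⟨g, hg⟩ := hexp x 0 hx0
    rw [smul_zero] at hg
    exact lt_asymm hg (hx g)
  obtain ⟨k, χ, hk, hχ, hker⟩ := exists_characters_dist_lt (X := X) hc
  have hinj : Function.Injective (orbitMap (Γ := Γ) χ) := by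
    refine (injective_iff_map_eq_zero _).mpr fun x hx => hexp0 x fun g => hker _ fun j => ?_
    have := congrFun (congrFun hx g⁻¹) j
    simpa [orbitMap] using this
  obtain ⟨A, hAJ, hA⟩ := EllOne.exists_isUnit_map_ofGroupRing
    (groupRingAnnihilator (orbitMap (Γ := Γ) χ).range)
    fun x ⟨_, hx⟩ hxm => eq_zero_of_orthogonal_annihilator hχ hinj hc hexp0 hx hxm
  have hmem : ∀ x, orbitMap (Γ := Γ) χ x ∈ XA A := fun x g i => by
    have h := hAJ i (orbitMap χ (g⁻¹ • x)) ⟨_, rfl⟩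
    simpa only [groupRingPairing, orbitMap_smul, inv_inv] using h
  refine ⟨k, A, hk, hA, fun m hm => ?_, ?_⟩
  · have hd := XA.hasBasis_uniformity A m hm
    exact ⟨XA.isExpansive hd hA, XA.hasPseudoOrbitTracing hd hA⟩
  · refine ⟨{ toFun := fun x => ⟨orbitMap χ x, hmem x⟩
              map_smul' := fun g x => Subtype.ext (funext fun h => orbitMap_smul χ g x h)
              map_zero' := Subtype.ext (map_zero _)
              map_add' := fun x y => Subtype.ext (map_add _ x y) }, ?_, ?_⟩
    · exact (continuous_orbitMap hχ).subtype_mk hmem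
    · exact fun x y hxy => hinj (congrArg Subtype.val hxy)
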